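/- **Theorem A.2 (Bootstrap multivariate CLT for triangular arrays).** Let $q\in\mathbb N$ and let $(k_n)_{n}$ be positive integers with $k_n\to\infty$. On a probability space $(\Omega,\mathcal F,\mathsf P)$ let $\{\boldsymbol\xi_{n,i}: 1\le i\le k_n\}_n$ be a triangular array of zero mean $q$-dimensional random vectors $\boldsymbol\xi_{n,i}=[\xi_{n,i}^{(1)},\dots,\xi_{n,i}^{(q)}]^\top$ such that, for every $n$, the vectors $\boldsymbol\xi_{n,1},\dots,\boldsymbol\xi_{n,k_n}$ are independent and identically distributed, and $$\sup_{n}\mathsf E\,|\xi_{n,1}^{(j)}|^4<\infty,\qquad j=1,\dots,q.$$ Let $\boldsymbol\Xi_n=[\boldsymbol\xi_{n,1},\dots,\boldsymbol\xi_{n,k_n}]$ and let $\boldsymbol\Xi_n^*=[\boldsymbol\xi_{n,1}^*,\dots,\boldsymbol\xi_{n,k_n}^*]$ be its bootstrap version: conditionally on $\boldsymbol\Xi_n$, the vectors $\boldsymbol\xi^*_{n,1},\dots,\boldsymbol\xi^*_{n,k_n}$ are independent, each with the discrete uniform distribution on $\{\boldsymbol\xi_{n,1},\dots,\boldsymbol\xi_{n,k_n}\}$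 (mass $1/k_n$ on each, counted with multiplicity). Write $\mathsf P^*_{\boldsymbol\Xi_n}$ for the conditional probability given $\boldsymbol\Xi_n$, and $$\bar{\boldsymbol\xi}_n=k_n^{-1}\sum_{i=1}^{k_n}\boldsymbol\xi_{n,i},\qquad \bar{\boldsymbol\xi}^*_n=k_n^{-1}\sum_{i=1}^{k_n}\boldsymbol\xi^*_{n,i},\qquad \boldsymbol\Gamma_n=\mathsf{Var}\,\boldsymbol\xi_{n,1}.$$ Suppose that the matrices $\boldsymbol\Gamma_n$ have a positive definite limit inferior in the sense of quadratic forms, that is, there is a positive definite matrix $\boldsymbol\Gamma$ with $$\liminf_{n\to\infty}\mathbf v^\top\boldsymbol\Gamma_n\mathbf v\ \ge\ \mathbf v^\top\boldsymbol\Gamma\,\mathbf v\qquad\text{for all }\mathbf v\in\mathbb R^q .$$ (Then $\boldsymbol\Gamma_n$ is positive definite for all large $n$, and $\boldsymbol\Gamma_n^{-1/2}$ denotes the symmetric positive definite inverse square root.) Then, for every $\mathbf x\in\mathbb R^q$, with $\le$ understood componentwise, $$\mathsf P^*_{\boldsymbol\Xi_n}\!\left[\sqrt{k_n}\,\boldsymbol\Gamma_n^{-1/2}\bigl(\bar{\boldsymbol\xi}^*_n-\bar{\boldsymbol\xi}_n\bigr)\le\mathbf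 x\right]-\mathsf P\!\left[\sqrt{k_n}\,\boldsymbol\Gamma_n^{-1/2}\bar{\boldsymbol\xi}_n\le\mathbf x\right]\xrightarrow[n\to\infty]{\mathsf P}0 .$$ -/

import Mathlib

open MeasureTheory ProbabilityTheory Filter Topology
open scoped ENNReal Matrix

/-- The covariance matrix `Var X` of a random vector `X` with values in `ℝ^q`. -/
noncomputable def covMatrix {Ω : Type*} [MeasurableSpace Ω] {q : ℕ}
    (X : Ω → Fin q → ℝ) (μ : Measure Ω) : Matrix (Fin q) (Fin q) ℝ :=
  Matrix.of fun i j => cov[fun ω => X ω i, fun ω => X ω j; μ]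

/-- The symmetric inverse square root `M^{-1/2}` of a positive definite real matrix, obtained by
applying `x ↦ x^{-1/2}` to the eigenvalues of `M`. -/
noncomputable def invSqrt {q : ℕ} (M : Matrix (Fin q) (Fin q) ℝ) : Matrix (Fin q) (Fin q) ℝ :=
  cfc (fun x : ℝ => x ^ (-(1 / 2) : ℝ)) M

/-- The arithmetic mean `k⁻¹ ∑ z_i` of `k` vectors. -/
noncomputable def sampleMean {k q : ℕ} (z : Fin k → Fin q → ℝ) : Fin q → ℝ :=
  (k : ℝ)⁻¹ • ∑ i, z i

/-- The discrete uniform distribution on a sample `z_1, …, z_k`: mass `1 / k` on each sample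
point, counted with multiplicity. -/
noncomputable def empiricalMeasure {k q : ℕ} (z : Fin k → Fin q → ℝ) : Measure (Fin q → ℝ) :=
  (k : ℝ≥0∞)⁻¹ • ∑ j, Measure.dirac (z j)

/-- `Xs` is a bootstrap version of the sample `X`: conditionally on `X`, the components of `Xs`
are drawn independently (with replacement) from the discrete uniform distribution on
`X_1, …, X_k`. -/
def IsBootstrapVersion {Ω : Type*} [MeasurableSpace Ω] {k q : ℕ}
    (Xs X : Ω → Fin k → Fin q → ℝ) (μ : Measure Ω) [IsFiniteMeasure μ] : Prop :=
  Measurable Xs ∧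
    ∀ᵐ z ∂(μ.map X), condDistrib Xs X μ z = Measure.pi fun _ : Fin k => empiricalMeasure z

/-- `Γ` is an asymptotic lower bound of the symmetric matrices `M_n` in the Loewner order,
expressed through quadratic forms: `vᵀ Γ v ≤ liminf_n vᵀ M_n v` for all `v`. -/
def IsLiminfLowerBound {q : ℕ} (Γ : Matrix (Fin q) (Fin q) ℝ)
    (M : ℕ → Matrix (Fin q) (Fin q) ℝ) : Prop :=
  ∀ v : Fin q → ℝ, v ⬝ᵥ (Γ *ᵥ v) ≤ liminf (fun n => v ⬝ᵥ (M n *ᵥ v)) atTop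

/-! Both probabilities converge to the same limit, the standard Gaussian mass of the orthant below
`x`, so their difference vanishes. One central limit theorem, `tendsto_pi_sampleMean`, serves both:
row averages of iid vectors are asymptotically standard normal as soon as the standardised second
moments converge to the identity and the third absolute moments are `o(√k)`. It is proved with
characteristic functions.

For the original array the matrix `Γ_n^{-1/2}` standardises exactly for large `n`. Compactness of
the unit sphere turns the liminf hypothesis into a uniform lower bound on the quadratic forms of
`Γ_n` (`exists_forall_mul_sq_norm_le_covMatrix`), so the standardised fourth moments stay bounded.

For the bootstrap, the conditional law given the data is that of an iid sample from the empirical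
measure, and the theorem applies to each deterministic sequence of samples whose `sampleDiscrepancy`
tends to zero. Taking limits along a filter on pairs (row, sample) makes this uniform over samples
of small discrepancy (`exists_forall_abs_sub_lt_of_sampleDiscrepancy_lt`). The expected discrepancy
tends to zero by variance bounds, and Markov's inequality gives convergence in probability. -/

/-! ### Taylor estimates and limits of powers for characteristic functions. -/

theorem norm_cexp_mul_I_sub_taylor_le (u : ℝ) :
    ‖Complex.exp (u * Complex.I) - (1 + u * Complex.I - u ^ 2 / 2)‖ ≤ 4 * |u| ^ 3 := by
  have hn : ‖(u * Complex.I : ℂ)‖ = |u| := by simp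
  rcases le_total |u| 1 with h | h
  · have := Complex.exp_bound (x := u * Complex.I) (by rwa [hn]) (n := 3) (by norm_num)
    rw [hn] at this
    have e : ∑ m ∈ Finset.range 3, (u * Complex.I : ℂ) ^ m / (m.factorial : ℂ)
        = 1 + u * Complex.I - u ^ 2 / 2 := by
      simp [Finset.sum_range_succ, Nat.factorial, mul_pow]
      ring
    rw [e] at this
    refine this.trans ?_
    rw [mul_comm]
    gcongr
    norm_num [Nat.factorial]
  -- For `|u| ≥ 1` no cancellation is needed: the terms add up to at most `(2 + 1 + 1/2) |u|³`,
  -- whence the crude constant 4.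
  · have h1 : ‖Complex.exp (u * Complex.I)‖ = 1 := Complex.norm_exp_ofReal_mul_I u
    have h2 : ‖(u ^ 2 / 2 : ℂ)‖ = |u| ^ 2 / 2 := by simp
    calc _ ≤ ‖Complex.exp (u * Complex.I)‖ + (‖(1 : ℂ)‖ + ‖(u * Complex.I : ℂ)‖
          + ‖(u ^ 2 / 2 : ℂ)‖) := by
          refine (norm_sub_le _ _).trans ?_
          gcongr
          refine (norm_sub_le _ _).trans ?_
          gcongr
          exact norm_add_le _ _
      _ = 2 + |u| + |u| ^ 2 / 2 := by rw [h1, hn, h2]; simp; ring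
      _ ≤ 4 * |u| ^ 3 := by
          have a2 : |u| ≤ |u| ^ 2 := le_self_pow₀ h (by norm_num)
          have a3 : |u| ^ 2 ≤ |u| ^ 3 := pow_le_pow_right₀ h (by norm_num)
          nlinarith

section
variable {Ω : Type*} [MeasurableSpace Ω] {P : Measure Ω} [IsProbabilityMeasure P] {f : Ω → ℝ}

theorem integrable_pow_of_integrable_abs_pow {m n : ℕ} (hmn : m ≤ n) (hf : Measurable f)
    (h : Integrable (fun ω => |f ω| ^ n) P) : Integrable (fun ω => f ω ^ m) P := by
  refine ((integrable_const (1 : ℝ)).add h).mono' (hf.pow_const m).aestronglyMeasurable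
    (ae_of_all _ fun ω => ?_)
  simp only [Pi.add_apply, norm_pow, Real.norm_eq_abs]
  rcases le_total |f ω| 1 with h1 | h1
  · have := pow_le_one₀ (n := m) (abs_nonneg (f ω)) h1
    have := pow_nonneg (abs_nonneg (f ω)) n
    linarith
  · have := pow_le_pow_right₀ h1 hmn
    linarith

theorem norm_integral_cexp_sub_le (hf : Measurable f) (h3 : Integrable (fun ω => |f ω| ^ 3) P)
    (h0 : ∫ ω, f ω ∂P = 0) :
    ‖∫ ω, Complex.exp (f ω * Complex.I) ∂P - (1 - ((∫ ω, f ω ^ 2 ∂P : ℝ) : ℂ) / 2)‖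
      ≤ 4 * ∫ ω, |f ω| ^ 3 ∂P := by
  have i1 : Integrable f P := by
    simpa using integrable_pow_of_integrable_abs_pow (m := 1) (by norm_num) hf h3
  have i2 := integrable_pow_of_integrable_abs_pow (m := 2) (by norm_num) hf h3
  have i1' : Integrable (fun ω => (f ω : ℂ) * Complex.I) P := i1.ofReal.mul_const _
  have i2' : Integrable (fun ω => (f ω : ℂ) ^ 2 / 2) P := by
    simpa using (i2.ofReal (𝕜 := ℂ)).div_const 2
  have ie : Integrable (fun ω => Complex.exp (f ω * Complex.I)) P := by
    refine (integrable_const (1 : ℝ)).mono' (by fun_prop) (ae_of_all _ fun ω => ?_)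
    simp [Complex.norm_exp_ofReal_mul_I]
  have it : Integrable (fun ω => (1 : ℂ) + f ω * Complex.I - (f ω : ℂ) ^ 2 / 2) P :=
    ((integrable_const _).add i1').sub i2'
  have e : (1 - ((∫ ω, f ω ^ 2 ∂P : ℝ) : ℂ) / 2)
      = ∫ ω, ((1 : ℂ) + f ω * Complex.I - (f ω : ℂ) ^ 2 / 2) ∂P := by
    have hadd : Integrable (fun ω => (1 : ℂ) + f ω * Complex.I) P := (integrable_const _).add i1'
    rw [integral_sub hadd i2', integral_add (integrable_const _) i1',
      integral_mul_const, integral_complex_ofReal, h0, integral_div]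
    have : ∫ ω, (f ω : ℂ) ^ 2 ∂P = ((∫ ω, f ω ^ 2 ∂P : ℝ) : ℂ) := by
      rw [← integral_complex_ofReal]; simp
    rw [this]; simp
  rw [e, ← integral_sub ie it, ← integral_const_mul]
  exact norm_integral_le_of_norm_le (h3.const_mul 4)
    (ae_of_all _ fun ω => norm_cexp_mul_I_sub_taylor_le (f ω))

end

theorem norm_pow_sub_pow_le_of_norm_le_one {a b : ℂ} (ha : ‖a‖ ≤ 1) (hb : ‖b‖ ≤ 1) (n : ℕ) :
    ‖a ^ n - b ^ n‖ ≤ n * ‖a - b‖ := by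
  induction n with
  | zero => simp
  | succ n ih =>
    have e : a ^ (n + 1) - b ^ (n + 1) = a ^ n * (a - b) + (a ^ n - b ^ n) * b := by ring
    rw [e]
    refine (norm_add_le _ _).trans ?_
    rw [norm_mul, norm_mul, norm_pow]
    have h1 : ‖a‖ ^ n * ‖a - b‖ ≤ 1 * ‖a - b‖ := by
      gcongr; exact pow_le_one₀ (norm_nonneg _) ha
    have h2 : ‖a ^ n - b ^ n‖ * ‖b‖ ≤ (n * ‖a - b‖) * 1 := by gcongr
    push_cast
    linarith

theorem tendsto_mul_exp_div_sub_one {ι : Type*} {l : Filter ι} {k : ι → ℕ}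
    (hk : Tendsto k l atTop) (s : ℝ) :
    Tendsto (fun i => (k i : ℝ) * (Real.exp (s / k i) - 1)) l (𝓝 s) := by
  have hd : HasDerivAt (fun x : ℝ => Real.exp (s * x)) s 0 := by
    simpa using ((hasDerivAt_id (0 : ℝ)).const_mul s).exp
  have h := hd.tendsto_slope_zero
  have hinv : Tendsto (fun i => ((k i : ℝ))⁻¹) l (𝓝[≠] 0) := by
    refine tendsto_nhdsWithin_iff.2 ⟨tendsto_inv_atTop_zero.comp
      (tendsto_natCast_atTop_atTop.comp hk), ?_⟩
    filter_upwards [hk.eventually_gt_atTop 0] with i hi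
    have : (k i : ℝ) ≠ 0 := by exact_mod_cast hi.ne'
    simpa using this
  refine (h.comp hinv).congr fun i => ?_
  simp [div_eq_mul_inv]

/-- Comparison with `exp (s / k)`, whose `k`-th power is exactly `exp s`, avoids complex logarithms.
The sign of `s` keeps both bases in the unit disc, where taking `k`-th powers enlarges distances by
at most the factor `k`. -/
theorem tendsto_pow_cexp_of_tendsto_mul_sub_one {ι : Type*} {l : Filter ι} {k : ι → ℕ}
    (hk : Tendsto k l atTop) {a : ι → ℂ} (ha : ∀ i, ‖a i‖ ≤ 1) {s : ℝ} (hs : s ≤ 0)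
    (h : Tendsto (fun i => (k i : ℂ) * (a i - 1)) l (𝓝 s)) :
    Tendsto (fun i => a i ^ k i) l (𝓝 (Complex.exp s)) := by
  have hb : ∀ i, ‖((Real.exp (s / k i) : ℝ) : ℂ)‖ ≤ 1 := fun i => by
    rw [Complex.norm_real, Real.norm_eq_abs, Real.abs_exp, Real.exp_le_one_iff]
    exact div_nonpos_of_nonpos_of_nonneg hs (Nat.cast_nonneg _)
  have h' : Tendsto (fun i => (((k i : ℝ) * (Real.exp (s / k i) - 1) : ℝ) : ℂ)) l (𝓝 (s : ℂ)) :=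
    (Complex.continuous_ofReal.tendsto s).comp (tendsto_mul_exp_div_sub_one hk s)
  have hd := (h.sub h').norm
  rw [sub_self, norm_zero] at hd
  have hz : Tendsto (fun i => a i ^ k i - ((Real.exp (s / k i) : ℝ) : ℂ) ^ k i) l (𝓝 0) := by
    refine squeeze_zero_norm (fun i => ?_) hd
    refine (norm_pow_sub_pow_le_of_norm_le_one (ha i) (hb i) (k i)).trans (le_of_eq ?_)
    have (w : ℂ) : (k i : ℝ) * ‖w‖ = ‖(k i : ℂ) * w‖ := by simp
    rw [this]
    congr 1
    push_cast
    ring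
  have := hz.add_const (Complex.exp s)
  rw [zero_add] at this
  refine this.congr' ?_
  filter_upwards [hk.eventually_gt_atTop 0] with i hi
  have hki : (k i : ℂ) ≠ 0 := by exact_mod_cast hi.ne'
  push_cast
  rw [← Complex.exp_nat_mul, mul_div_cancel₀ _ hki]
  ring

/-! ### From characteristic functions to orthant probabilities. -/

theorem frontier_Iic_subset_iUnion {ι : Type*} [Finite ι] (x : ι → ℝ) :
    frontier (Set.Iic x) ⊆ ⋃ j, {y : ι → ℝ | y j = x j} := by
  intro y hy
  rw [frontier, isClosed_Iic.closure_eq] at hy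
  by_contra hne
  simp only [Set.mem_iUnion, Set.mem_ofPred_eq, not_exists] at hne
  refine hy.2 (mem_interior.2 ⟨{z | ∀ j, z j < x j}, fun z hz j => (hz j).le, ?_,
    fun j => lt_of_le_of_ne (hy.1 j) (hne j)⟩)
  simp only [Set.ofPred_forall]
  exact isOpen_iInter_of_finite fun j => isOpen_lt (continuous_apply j) continuous_const

theorem measure_pi_frontier_Iic_eq_zero {ι : Type*} [Fintype ι] (ν : ι → Measure ℝ)
    [∀ j, IsProbabilityMeasure (ν j)] [∀ j, NullSingletonClass (ν j)] (x : ι → ℝ) :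
    Measure.pi ν (frontier (Set.Iic x)) = 0 := by
  refine measure_mono_null (frontier_Iic_subset_iUnion x) (measure_iUnion_null fun j => ?_)
  have := (measurePreserving_eval ν j).measure_preimage
    (measurableSet_singleton (x j)).nullMeasurableSet
  rw [measure_singleton] at this
  exact this

/-- Lévy's continuity theorem followed by the portmanteau theorem: the boundary of an orthant lies
in finitely many coordinate hyperplanes, which are Gaussian null sets. Characteristic functions need
the inner product, hence the passage through `EuclideanSpace`. -/
theorem tendsto_measureReal_Iic_of_tendsto_charFun {q : ℕ} {P : ℕ → Measure (EuclideanSpace ℝ (Fin q))}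
    [∀ i, IsProbabilityMeasure (P i)]
    (h : ∀ t, Tendsto (fun i => charFun (P i) t) atTop (𝓝 (Complex.exp (-‖t‖ ^ 2 / 2))))
    (x : Fin q → ℝ) :
    Tendsto (fun i => (P i).real {y | y.ofLp ≤ x}) atTop
      (𝓝 ((Measure.pi fun _ : Fin q => gaussianReal 0 1).real (Set.Iic x))) := by
  obtain ⟨Q, hQ⟩ : ∃ Q : ℕ → ProbabilityMeasure (EuclideanSpace ℝ (Fin q)),
      ∀ i, (Q i : Measure (EuclideanSpace ℝ (Fin q))) = P i :=
    ⟨fun i => ⟨P i, inferInstance⟩, fun _ => rfl⟩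
  obtain ⟨G, hG⟩ : ∃ G : ProbabilityMeasure (EuclideanSpace ℝ (Fin q)),
      (G : Measure (EuclideanSpace ℝ (Fin q))) = stdGaussian _ :=
    ⟨⟨stdGaussian _, inferInstance⟩, rfl⟩
  have key : Tendsto Q atTop (𝓝 G) := by
    refine ProbabilityMeasure.tendsto_of_tendsto_charFun fun t => ?_
    simp only [hQ, hG, charFun_stdGaussian]
    exact h t
  have hcont : Continuous (fun y : EuclideanSpace ℝ (Fin q) => y.ofLp) := by fun_prop
  have hmap := ProbabilityMeasure.tendsto_map_of_tendsto_of_continuous _ _ key hcont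
  have hg : (stdGaussian (EuclideanSpace ℝ (Fin q))).map (fun y => y.ofLp)
      = Measure.pi fun _ : Fin q => gaussianReal 0 1 := by
    rw [← map_pi_eq_stdGaussian, Measure.map_map (by fun_prop) (by fun_prop)]
    exact Measure.map_id
  have : NullSingletonClass (gaussianReal 0 1) := nullSingletonClass_gaussianReal one_ne_zero
  have hfin := ProbabilityMeasure.tendsto_measure_of_null_frontier_of_tendsto' hmap
    (E := Set.Iic x) (by
      rw [ProbabilityMeasure.toMeasure_map, hG, hg]
      exact measure_pi_frontier_Iic_eq_zero _ x)
  simp only [ProbabilityMeasure.toMeasure_map, hQ, hG, hg] at hfin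
  have hreal := (ENNReal.tendsto_toReal (measure_ne_top _ _)).comp hfin
  refine hreal.congr fun i => ?_
  simp only [Function.comp_apply]
  rw [Measure.map_apply hcont.measurable measurableSet_Iic]
  rfl

/-! ### Central limit theorem for iid rows under a Lyapunov condition. -/

section
variable {q : ℕ}

theorem charFun_map_sum_pi_const {k : ℕ} (ρ : Measure (Fin q → ℝ)) [IsProbabilityMeasure ρ]
    {g : (Fin q → ℝ) → EuclideanSpace ℝ (Fin q)} (hg : Measurable g)
    (t : EuclideanSpace ℝ (Fin q)) :
    charFun ((Measure.pi fun _ : Fin k => ρ).map fun zs => ∑ i, g (zs i)) t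
      = (∫ y, Complex.exp ((inner ℝ (g y) t : ℝ) * Complex.I) ∂ρ) ^ k := by
  have hind : iIndepFun (fun (i : Fin k) (zs : Fin k → Fin q → ℝ) => g (zs i))
      (Measure.pi fun _ : Fin k => ρ) := iIndepFun_pi fun _ => hg.aemeasurable
  have hm (i : Fin k) : Measurable fun zs : Fin k → Fin q → ℝ => g (zs i) :=
    hg.comp (measurable_pi_apply i)
  rw [hind.charFun_map_fun_sum_eq_prod fun i => (hm i).aemeasurable, Finset.prod_apply]
  have (i : Fin k) : charFun ((Measure.pi fun _ : Fin k => ρ).map fun zs => g (zs i)) t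
      = ∫ y, Complex.exp ((inner ℝ (g y) t : ℝ) * Complex.I) ∂ρ := by
    have h1 : (Measure.pi fun _ : Fin k => ρ).map (fun zs => g (zs i)) = ρ.map g := by
      conv_rhs => rw [← (measurePreserving_eval (fun _ : Fin k => ρ) i).map_eq,
        Measure.map_map hg (measurable_pi_apply i)]
      rfl
    rw [h1, charFun_apply, integral_map hg.aemeasurable (by fun_prop)]
  simp [this]

theorem sqrt_smul_mulVec_sampleMean_sub {k : ℕ} (hk : k ≠ 0) (A : Matrix (Fin q) (Fin q) ℝ)
    (m : Fin q → ℝ) (z : Fin k → Fin q → ℝ) :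
    √(k : ℝ) • (A *ᵥ (sampleMean z - m)) = ∑ i, (√(k : ℝ))⁻¹ • (A *ᵥ (z i - m)) := by
  have hk' : (0 : ℝ) < k := by exact_mod_cast Nat.pos_of_ne_zero hk
  have hs : √(k : ℝ) ≠ 0 := (Real.sqrt_pos.2 hk').ne'
  have h1 : sampleMean z - m = (k : ℝ)⁻¹ • ∑ i, (z i - m) := by
    rw [sampleMean, Finset.sum_sub_distrib, smul_sub]
    simp [← Nat.cast_smul_eq_nsmul ℝ, smul_smul, hk'.ne']
  rw [h1, Matrix.mulVec_smul, smul_smul, ← Finset.smul_sum, Matrix.mulVec_sum]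
  congr 1
  field_simp
  exact Real.sq_sqrt hk'.le

theorem tendsto_pi_sampleMean_of_seq {k : ℕ → ℕ} (hk : Tendsto k atTop atTop)
    (A : ℕ → Matrix (Fin q) (Fin q) ℝ) (ρ : ℕ → Measure (Fin q → ℝ))
    [∀ i, IsProbabilityMeasure (ρ i)] (m : ℕ → Fin q → ℝ)
    (h3 : ∀ t i, Integrable (fun y => |t ⬝ᵥ (A i *ᵥ (y - m i))| ^ 3) (ρ i))
    (h0 : ∀ t i, ∫ y, t ⬝ᵥ (A i *ᵥ (y - m i)) ∂(ρ i) = 0)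
    (h2 : ∀ t, Tendsto (fun i => ∫ y, (t ⬝ᵥ (A i *ᵥ (y - m i))) ^ 2 ∂(ρ i)) atTop (𝓝 (t ⬝ᵥ t)))
    (hL : ∀ t, Tendsto (fun i => (∫ y, |t ⬝ᵥ (A i *ᵥ (y - m i))| ^ 3 ∂(ρ i)) / √(k i)) atTop (𝓝 0))
    (x : Fin q → ℝ) :
    Tendsto (fun i => (Measure.pi fun _ : Fin (k i) => ρ i).real
        {z | √(k i : ℝ) • (A i *ᵥ (sampleMean z - m i)) ≤ x}) atTop
      (𝓝 ((Measure.pi fun _ : Fin q => gaussianReal 0 1).real (Set.Iic x))) := by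
  have hcA (i : ℕ) : Continuous fun y => A i *ᵥ (y - m i) :=
    (Continuous.matrix_mulVec continuous_const (by fun_prop))
  let g (i : ℕ) (y : Fin q → ℝ) : EuclideanSpace ℝ (Fin q) :=
    WithLp.toLp 2 ((√(k i : ℝ))⁻¹ • (A i *ᵥ (y - m i)))
  have hg (i : ℕ) : Measurable (g i) :=
    ((PiLp.continuous_toLp 2 _).comp ((hcA i).const_smul (√(k i : ℝ))⁻¹)).measurable
  have hgs (i : ℕ) : Measurable fun z : Fin (k i) → Fin q → ℝ => ∑ j, g i (z j) :=
    Finset.measurable_sum _ fun j _ => (hg i).comp (measurable_pi_apply j)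
  let P (i : ℕ) := (Measure.pi fun _ : Fin (k i) => ρ i).map fun z => ∑ j, g i (z j)
  have hP (i : ℕ) : IsProbabilityMeasure (P i) :=
    Measure.isProbabilityMeasure_map (hgs i).aemeasurable
  have hchar : ∀ t, Tendsto (fun i => charFun (P i) t) atTop
      (𝓝 (Complex.exp (-‖t‖ ^ 2 / 2))) := by
    intro t
    let f (i : ℕ) (y : Fin q → ℝ) : ℝ := t.ofLp ⬝ᵥ (A i *ᵥ (y - m i))
    have hf (i : ℕ) : Measurable (f i) := (continuous_const.dotProduct (hcA i)).measurable
    have hinner (i : ℕ) (y) : (inner ℝ (g i y) t : ℝ) = (√(k i : ℝ))⁻¹ * f i y := by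
      simp [g, f, EuclideanSpace.inner_eq_star_dotProduct]
    have hpow : ((-‖t‖ ^ 2 / 2 : ℂ)) = ((-(‖t‖ ^ 2 / 2) : ℝ) : ℂ) := by push_cast; ring
    simp only [P, charFun_map_sum_pi_const _ (hg _), hinner]
    rw [hpow]
    refine tendsto_pow_cexp_of_tendsto_mul_sub_one hk (fun i => ?_)
      (neg_nonpos.2 (by positivity)) ?_
    · refine (norm_integral_le_of_norm_le_const (C := 1) (ae_of_all _ fun y => ?_)).trans (by simp)
      rw [Complex.norm_exp_ofReal_mul_I]
    have hv := h2 t.ofLp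
    have hn : t.ofLp ⬝ᵥ t.ofLp = ‖t‖ ^ 2 := by
      rw [EuclideanSpace.real_norm_sq_eq]
      simp [dotProduct, sq]
    rw [hn] at hv
    have hv' : Tendsto (fun i => ((-((∫ y, f i y ^ 2 ∂(ρ i)) / 2) : ℝ) : ℂ)) atTop
        (𝓝 ((-(‖t‖ ^ 2 / 2) : ℝ) : ℂ)) :=
      (Complex.continuous_ofReal.tendsto _).comp (hv.div_const 2).neg
    -- The Taylor error per summand is `4 k^{-3/2} ∫ |f|³`; multiplied by `k` it is four times the
    -- Lyapunov ratio of `hL`.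
    have hz : Tendsto (fun i => (k i : ℂ) *
          (∫ y, Complex.exp (((√(k i : ℝ))⁻¹ * f i y : ℝ) * Complex.I) ∂(ρ i) - 1)
          - ((-((∫ y, f i y ^ 2 ∂(ρ i)) / 2) : ℝ) : ℂ)) atTop (𝓝 0) := by
      have hb := (hL t.ofLp).const_mul 4
      rw [mul_zero] at hb
      refine squeeze_zero_norm' ?_ hb
      filter_upwards [hk.eventually_gt_atTop 0] with i hi
      have hk' : (0 : ℝ) < k i := by exact_mod_cast hi
      have hs : 0 < √(k i : ℝ) := Real.sqrt_pos.2 hk'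
      have hsq : √(k i : ℝ) ^ 2 = k i := Real.sq_sqrt hk'.le
      have habs (y) : |(√(k i : ℝ))⁻¹ * f i y| ^ 3 = ((√(k i : ℝ))⁻¹) ^ 3 * |f i y| ^ 3 := by
        rw [abs_mul, mul_pow, abs_of_pos (inv_pos.2 hs)]
      have h3i : Integrable (fun y => |(√(k i : ℝ))⁻¹ * f i y| ^ 3) (ρ i) := by
        simp only [habs]
        exact (h3 t.ofLp i).const_mul _
      have := norm_integral_cexp_sub_le (P := ρ i) ((hf i).const_mul _) h3i
        (by rw [integral_const_mul, show ∫ y, f i y ∂(ρ i) = 0 from h0 t.ofLp i, mul_zero])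
      simp only [habs, mul_pow, integral_const_mul] at this
      have h4 := mul_le_mul_of_nonneg_left this hk'.le
      have hw (w : ℂ) : (k i : ℝ) * ‖w‖ = ‖(k i : ℂ) * w‖ := by simp
      rw [hw] at h4
      refine (le_of_eq ?_).trans (h4.trans (le_of_eq ?_))
      · congr 1
        rw [inv_pow, hsq]
        have : (k i : ℂ) ≠ 0 := by exact_mod_cast hi.ne'
        rw [mul_sub, mul_sub, mul_sub, Complex.ofReal_mul, Complex.ofReal_neg, Complex.ofReal_div,
          Complex.ofReal_inv, Complex.ofReal_natCast, mul_div_assoc', mul_inv_cancel_left₀ this]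
        push_cast
        ring
      · change (k i : ℝ) * (4 * (((√(k i : ℝ))⁻¹) ^ 3 * ∫ y, |f i y| ^ 3 ∂(ρ i)))
          = 4 * ((∫ y, |f i y| ^ 3 ∂(ρ i)) / √(k i : ℝ))
        rw [← hsq]
        rw [Real.sqrt_sq hs.le]
        field_simp
    simpa using hz.add hv'
  refine (tendsto_measureReal_Iic_of_tendsto_charFun hchar x).congr' ?_
  filter_upwards [hk.eventually_gt_atTop 0] with i hi
  simp only [P]
  rw [map_measureReal_apply (hgs i)]
  · congr 1
    ext z
    simp only [Set.mem_preimage, Set.mem_ofPred_eq]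
    rw [sqrt_smul_mulVec_sampleMean_sub hi.ne']
    simp [g]
  · exact (isClosed_Iic.preimage (PiLp.continuous_ofLp 2 _)).measurableSet

/-- Lévy's theorem is used along sequences, and sequences detect limits along countably generated
filters. This generality allows the index to carry the sample itself. -/
theorem tendsto_pi_sampleMean {ι : Type*} {l : Filter ι} [l.IsCountablyGenerated] {k : ι → ℕ}
    (hk : Tendsto k l atTop)
    (A : ι → Matrix (Fin q) (Fin q) ℝ) (ρ : ι → Measure (Fin q → ℝ))
    [∀ i, IsProbabilityMeasure (ρ i)] (m : ι → Fin q → ℝ)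
    (h3 : ∀ t i, Integrable (fun y => |t ⬝ᵥ (A i *ᵥ (y - m i))| ^ 3) (ρ i))
    (h0 : ∀ t i, ∫ y, t ⬝ᵥ (A i *ᵥ (y - m i)) ∂(ρ i) = 0)
    (h2 : ∀ t, Tendsto (fun i => ∫ y, (t ⬝ᵥ (A i *ᵥ (y - m i))) ^ 2 ∂(ρ i)) l (𝓝 (t ⬝ᵥ t)))
    (hL : ∀ t, Tendsto (fun i => (∫ y, |t ⬝ᵥ (A i *ᵥ (y - m i))| ^ 3 ∂(ρ i)) / √(k i)) l (𝓝 0))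
    (x : Fin q → ℝ) :
    Tendsto (fun i => (Measure.pi fun _ : Fin (k i) => ρ i).real
        {z | √(k i : ℝ) • (A i *ᵥ (sampleMean z - m i)) ≤ x}) l
      (𝓝 ((Measure.pi fun _ : Fin q => gaussianReal 0 1).real (Set.Iic x))) :=
  tendsto_of_seq_tendsto fun u hu =>
    have (i : ℕ) : IsProbabilityMeasure ((ρ ∘ u) i) := inferInstanceAs (IsProbabilityMeasure (ρ (u i)))
    tendsto_pi_sampleMean_of_seq (hk.comp hu) (A ∘ u) (ρ ∘ u) (m ∘ u) (fun t i => h3 t (u i))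
      (fun t i => h0 t (u i)) (fun t => (h2 t).comp hu) (fun t => (hL t).comp hu) x
end

/-! ### Inverse square roots and elementary sup-norm bounds. -/

section InvSqrt
variable {q : ℕ} {M : Matrix (Fin q) (Fin q) ℝ}

/-- `cfc` always returns a self-adjoint element, its default value 0 included, so symmetry holds
even in rows where the covariance matrix is singular. -/
theorem transpose_invSqrt (M : Matrix (Fin q) (Fin q) ℝ) : (invSqrt M)ᵀ = invSqrt M := by
  have h : IsSelfAdjoint (invSqrt M) := cfc_predicate _ M
  rw [IsSelfAdjoint, Matrix.star_eq_conjTranspose, Matrix.conjTranspose_eq_transpose_of_trivial] at h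
  exact h

/-- In the functional calculus this is `x^{-1/2} · x · x^{-1/2} = 1` on the spectrum, which is
positive. -/
theorem invSqrt_mul_mul_invSqrt (hM : M.PosDef) : invSqrt M * M * invSqrt M = 1 := by
  have hsa : IsSelfAdjoint M := hM.isHermitian
  have hpos : ∀ x ∈ spectrum ℝ M, 0 < x := by
    intro x hx
    rw [hM.isHermitian.spectrum_real_eq_range_eigenvalues] at hx
    obtain ⟨i, rfl⟩ := hx
    exact hM.eigenvalues_pos i
  have hc : ContinuousOn (fun x : ℝ => x ^ (-(1 / 2) : ℝ)) (spectrum ℝ M) := fun x hx =>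
    (Real.continuousAt_rpow_const x _ (Or.inl (hpos x hx).ne')).continuousWithinAt
  have h1 : invSqrt M * M = cfc (fun x : ℝ => x ^ (-(1 / 2) : ℝ) * x) M := by
    rw [cfc_mul (fun x : ℝ => x ^ (-(1 / 2) : ℝ)) (fun x => x) M hc continuousOn_id, cfc_id' ℝ M]
    rfl
  rw [h1, invSqrt, ← cfc_mul (fun x : ℝ => x ^ (-(1 / 2) : ℝ) * x) _ M
    (hc.mul continuousOn_id) hc, ← cfc_one ℝ M]
  refine cfc_congr fun x hx => ?_
  have hx := hpos x hx
  simp only [Pi.one_apply]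
  calc x ^ (-(1 / 2) : ℝ) * x * x ^ (-(1 / 2) : ℝ)
      = x ^ (-(1 / 2) : ℝ) * x ^ (1 : ℝ) * x ^ (-(1 / 2) : ℝ) := by rw [Real.rpow_one]
    _ = 1 := by
      rw [← Real.rpow_add hx, ← Real.rpow_add hx]
      norm_num

end InvSqrt

section SupNorm
variable {q : ℕ}

theorem abs_dotProduct_le (t u : Fin q → ℝ) : |t ⬝ᵥ u| ≤ (∑ a, |t a|) * ‖u‖ := by
  rw [dotProduct, Finset.sum_mul]
  refine (Finset.abs_sum_le_sum_abs _ _).trans (Finset.sum_le_sum fun a _ => ?_)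
  rw [abs_mul]
  gcongr
  exact norm_le_pi_norm u a

theorem dotProduct_mulVec_sub (t : Fin q → ℝ) (A : Matrix (Fin q) (Fin q) ℝ) (y m : Fin q → ℝ) :
    t ⬝ᵥ (A *ᵥ (y - m)) = t ⬝ᵥ (A *ᵥ y) - t ⬝ᵥ (A *ᵥ m) := by
  rw [Matrix.mulVec_sub, dotProduct_sub]

theorem sq_dotProduct_eq_sum (t u : Fin q → ℝ) :
    (t ⬝ᵥ u) ^ 2 = ∑ a, ∑ b, t a * t b * (u a * u b) := by
  rw [sq, dotProduct, Finset.sum_mul_sum]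
  exact Finset.sum_congr rfl fun a _ => Finset.sum_congr rfl fun b _ => by ring

end SupNorm

/-! ### Moments of the empirical measure. -/

section Empirical
variable {q k : ℕ}

theorem integrable_empiricalMeasure [NeZero k] (z : Fin k → Fin q → ℝ) (f : (Fin q → ℝ) → ℝ) :
    Integrable f (empiricalMeasure z) := by
  refine Integrable.smul_measure (integrable_finsetSum_measure.2 fun j _ =>
    integrable_dirac (by simp)) (by simp [NeZero.ne k])

theorem integral_empiricalMeasure (z : Fin k → Fin q → ℝ) (f : (Fin q → ℝ) → ℝ) :
    ∫ y, f y ∂(empiricalMeasure z) = (k : ℝ)⁻¹ * ∑ i, f (z i) := by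
  rw [empiricalMeasure, integral_smul_measure,
    integral_finsetSum_measure fun j _ => integrable_dirac (by simp)]
  simp

instance isProbabilityMeasure_empiricalMeasure [NeZero k] (z : Fin k → Fin q → ℝ) :
    IsProbabilityMeasure (empiricalMeasure z) := by
  constructor
  simp [empiricalMeasure, ENNReal.inv_mul_cancel, NeZero.ne k]

/-- The discrepancy of the sample `A z_1, …, A z_k` from a standardised one: it is small when the
second moment matrix is close to the identity, the mean is close to zero and the third absolute
moment is small compared with `√k`. -/
noncomputable def sampleDiscrepancy (A : Matrix (Fin q) (Fin q) ℝ) (z : Fin k → Fin q → ℝ) : ℝ :=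
  (∑ a, ∑ b, ((k : ℝ)⁻¹ * ∑ i, (A *ᵥ z i) a * (A *ᵥ z i) b
      - (1 : Matrix (Fin q) (Fin q) ℝ) a b) ^ 2)
    + ∑ a, ((k : ℝ)⁻¹ * ∑ i, (A *ᵥ z i) a) ^ 2
    + ((k : ℝ)⁻¹ * ∑ i, ‖A *ᵥ z i‖ ^ 3) / √(k : ℝ)

/-- Allows the expected discrepancy to be estimated for already standardised vectors only. -/
theorem sampleDiscrepancy_eq (A : Matrix (Fin q) (Fin q) ℝ) (z : Fin k → Fin q → ℝ) :
    sampleDiscrepancy A z = sampleDiscrepancy 1 fun i => A *ᵥ z i := by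
  simp [sampleDiscrepancy]

theorem sampleDiscrepancy_nonneg (A : Matrix (Fin q) (Fin q) ℝ) (z : Fin k → Fin q → ℝ) :
    0 ≤ sampleDiscrepancy A z := by
  unfold sampleDiscrepancy
  positivity

theorem dotProduct_mulVec_sampleMean (t : Fin q → ℝ) (A : Matrix (Fin q) (Fin q) ℝ)
    (z : Fin k → Fin q → ℝ) :
    t ⬝ᵥ (A *ᵥ sampleMean z) = (k : ℝ)⁻¹ * ∑ i, t ⬝ᵥ (A *ᵥ z i) := by
  rw [sampleMean, Matrix.mulVec_smul, Matrix.mulVec_sum, dotProduct_smul, dotProduct_sum,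
    smul_eq_mul]

theorem integral_dotProduct_empiricalMeasure_eq_zero [NeZero k] (t : Fin q → ℝ)
    (A : Matrix (Fin q) (Fin q) ℝ) (z : Fin k → Fin q → ℝ) :
    ∫ y, t ⬝ᵥ (A *ᵥ (y - sampleMean z)) ∂(empiricalMeasure z) = 0 := by
  have hk : (k : ℝ) ≠ 0 := Nat.cast_ne_zero.2 (NeZero.ne k)
  rw [integral_empiricalMeasure]
  simp only [dotProduct_mulVec_sub, Finset.sum_sub_distrib, Finset.sum_const, Finset.card_univ,
    Fintype.card_fin, nsmul_eq_mul]
  rw [mul_sub, ← dotProduct_mulVec_sampleMean, inv_mul_cancel_left₀ hk, sub_self]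

theorem integral_sq_dotProduct_empiricalMeasure [NeZero k] (t : Fin q → ℝ)
    (A : Matrix (Fin q) (Fin q) ℝ) (z : Fin k → Fin q → ℝ) :
    ∫ y, (t ⬝ᵥ (A *ᵥ (y - sampleMean z))) ^ 2 ∂(empiricalMeasure z)
      = (∑ a, ∑ b, t a * t b * ((k : ℝ)⁻¹ * ∑ i, (A *ᵥ z i) a * (A *ᵥ z i) b))
        - (t ⬝ᵥ (A *ᵥ sampleMean z)) ^ 2 := by
  have hk : (k : ℝ) ≠ 0 := Nat.cast_ne_zero.2 (NeZero.ne k)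
  set s := t ⬝ᵥ (A *ᵥ sampleMean z) with hs
  have h1 : (k : ℝ)⁻¹ * ∑ i, (t ⬝ᵥ (A *ᵥ z i)) ^ 2
      = ∑ a, ∑ b, t a * t b * ((k : ℝ)⁻¹ * ∑ i, (A *ᵥ z i) a * (A *ᵥ z i) b) := by
    simp only [sq_dotProduct_eq_sum]
    rw [Finset.sum_comm, Finset.mul_sum]
    refine Finset.sum_congr rfl fun a _ => ?_
    rw [Finset.sum_comm, Finset.mul_sum]
    refine Finset.sum_congr rfl fun b _ => ?_
    rw [← Finset.mul_sum]
    ring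
  rw [integral_empiricalMeasure, ← h1]
  have h2 (i : Fin k) : (t ⬝ᵥ (A *ᵥ (z i - sampleMean z))) ^ 2
      = (t ⬝ᵥ (A *ᵥ z i)) ^ 2 - 2 * s * (t ⬝ᵥ (A *ᵥ z i)) + s ^ 2 := by
    rw [dotProduct_mulVec_sub]; ring
  simp only [h2, Finset.sum_add_distrib, Finset.sum_sub_distrib, ← Finset.mul_sum]
  have h3 : ∑ i, t ⬝ᵥ (A *ᵥ z i) = k * s := by
    rw [hs, dotProduct_mulVec_sampleMean, mul_inv_cancel_left₀ hk]
  rw [h3]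
  simp
  field_simp
  ring

theorem integral_abs_dotProduct_pow_empiricalMeasure_le [NeZero k] (t : Fin q → ℝ)
    (A : Matrix (Fin q) (Fin q) ℝ) (z : Fin k → Fin q → ℝ) :
    ∫ y, |t ⬝ᵥ (A *ᵥ (y - sampleMean z))| ^ 3 ∂(empiricalMeasure z)
      ≤ 4 * (∑ a, |t a|) ^ 3 * ((k : ℝ)⁻¹ * ∑ i, ‖A *ᵥ z i‖ ^ 3 + ‖A *ᵥ sampleMean z‖ ^ 3) := by
  have hk : (k : ℝ) ≠ 0 := Nat.cast_ne_zero.2 (NeZero.ne k)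
  have hT : 0 ≤ ∑ a, |t a| := Finset.sum_nonneg fun _ _ => abs_nonneg _
  rw [integral_empiricalMeasure]
  have h (i : Fin k) : |t ⬝ᵥ (A *ᵥ (z i - sampleMean z))| ^ 3
      ≤ 4 * (∑ a, |t a|) ^ 3 * (‖A *ᵥ z i‖ ^ 3 + ‖A *ᵥ sampleMean z‖ ^ 3) := by
    have h1 : |t ⬝ᵥ (A *ᵥ (z i - sampleMean z))|
        ≤ (∑ a, |t a|) * (‖A *ᵥ z i‖ + ‖A *ᵥ sampleMean z‖) := by
      refine (abs_dotProduct_le _ _).trans ?_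
      rw [Matrix.mulVec_sub]
      gcongr
      exact norm_sub_le _ _
    refine (pow_le_pow_left₀ (abs_nonneg _) h1 3).trans ?_
    rw [mul_pow]
    -- Convexity of the cube; the 4 is `2^(3-1)`.
    have h2 := add_pow_le (norm_nonneg (A *ᵥ z i)) (norm_nonneg (A *ᵥ sampleMean z)) 3
    have h3 := mul_le_mul_of_nonneg_left h2 (pow_nonneg hT 3)
    norm_num at h3
    linarith
  refine (mul_le_mul_of_nonneg_left (Finset.sum_le_sum fun i _ => h i) (by positivity)).trans ?_
  rw [← Finset.mul_sum, Finset.sum_add_distrib]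
  refine le_of_eq ?_
  simp
  field_simp

end Empirical

/-! ### The bootstrap limit theorem for deterministic samples. -/

section Bootstrap
variable {q : ℕ} {ι : Type*} {l : Filter ι}

theorem tendsto_zero_of_sampleDiscrepancy {k : ι → ℕ} {A : ι → Matrix (Fin q) (Fin q) ℝ}
    {z : ∀ i, Fin (k i) → Fin q → ℝ}
    (h : Tendsto (fun i => sampleDiscrepancy (A i) (z i)) l (𝓝 0)) :
    (∀ a b, Tendsto (fun i => (k i : ℝ)⁻¹ * ∑ j, (A i *ᵥ z i j) a * (A i *ᵥ z i j) b) l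
        (𝓝 ((1 : Matrix (Fin q) (Fin q) ℝ) a b))) ∧
      Tendsto (fun i => A i *ᵥ sampleMean (z i)) l (𝓝 0) ∧
      Tendsto (fun i => ((k i : ℝ)⁻¹ * ∑ j, ‖A i *ᵥ z i j‖ ^ 3) / √(k i : ℝ)) l (𝓝 0) := by
  have hsq {u : ι → ℝ} (hu : ∀ i, u i ^ 2 ≤ sampleDiscrepancy (A i) (z i)) :
      Tendsto u l (𝓝 0) := by
    have h1 : Tendsto (fun i => u i ^ 2) l (𝓝 0) := squeeze_zero (fun i => sq_nonneg _) hu h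
    have h2 := h1.sqrt
    simp only [Real.sqrt_sq_eq_abs, Real.sqrt_zero] at h2
    exact (tendsto_zero_iff_abs_tendsto_zero u).2 h2
  have n1 (i : ι) : 0 ≤ ∑ a, ∑ b, ((k i : ℝ)⁻¹ * ∑ j, (A i *ᵥ z i j) a * (A i *ᵥ z i j) b
      - (1 : Matrix (Fin q) (Fin q) ℝ) a b) ^ 2 :=
    Finset.sum_nonneg fun _ _ => Finset.sum_nonneg fun _ _ => sq_nonneg _
  have n2 (i : ι) : 0 ≤ ∑ a, ((k i : ℝ)⁻¹ * ∑ j, (A i *ᵥ z i j) a) ^ 2 :=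
    Finset.sum_nonneg fun _ _ => sq_nonneg _
  have n3 (i : ι) : 0 ≤ ((k i : ℝ)⁻¹ * ∑ j, ‖A i *ᵥ z i j‖ ^ 3) / √(k i : ℝ) := by positivity
  refine ⟨fun a b => ?_, tendsto_pi_nhds.2 fun a => hsq fun i => ?_,
    squeeze_zero n3 (fun i => ?_) h⟩
  · refine tendsto_sub_nhds_zero_iff.1 (hsq fun i => ?_)
    have h1 := Finset.single_le_sum (f := fun b => ((k i : ℝ)⁻¹ * ∑ j, (A i *ᵥ z i j) a *
      (A i *ᵥ z i j) b - (1 : Matrix (Fin q) (Fin q) ℝ) a b) ^ 2)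
      (fun _ _ => sq_nonneg _) (Finset.mem_univ b)
    have h2 := Finset.single_le_sum (f := fun a => ∑ b, ((k i : ℝ)⁻¹ * ∑ j, (A i *ᵥ z i j) a *
      (A i *ᵥ z i j) b - (1 : Matrix (Fin q) (Fin q) ℝ) a b) ^ 2)
      (fun _ _ => Finset.sum_nonneg fun _ _ => sq_nonneg _) (Finset.mem_univ a)
    have := n2 i
    have := n3 i
    simp only [sampleDiscrepancy]
    linarith
  · have h1 := Finset.single_le_sum (f := fun a => ((k i : ℝ)⁻¹ * ∑ j, (A i *ᵥ z i j) a) ^ 2)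
      (fun _ _ => sq_nonneg _) (Finset.mem_univ a)
    have e : (A i *ᵥ sampleMean (z i)) a = (k i : ℝ)⁻¹ * ∑ j, (A i *ᵥ z i j) a := by
      have := dotProduct_mulVec_sampleMean (Pi.single a 1) (A i) (z i)
      simpa using this
    rw [e]
    have := n1 i
    have := n3 i
    simp only [sampleDiscrepancy]
    linarith
  · have := n1 i
    have := n2 i
    simp only [sampleDiscrepancy]
    linarith

/-- The central limit theorem is applied to the empirical measures. Centring at the sample mean is
harmless in the limit, because the standardised sample mean tends to zero. -/
theorem tendsto_pi_empiricalMeasure_sampleMean [l.IsCountablyGenerated] {k : ι → ℕ}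
    [∀ i, NeZero (k i)] (hk : Tendsto k l atTop) (A : ι → Matrix (Fin q) (Fin q) ℝ)
    (z : ∀ i, Fin (k i) → Fin q → ℝ)
    (h : Tendsto (fun i => sampleDiscrepancy (A i) (z i)) l (𝓝 0)) (x : Fin q → ℝ) :
    Tendsto (fun i => (Measure.pi fun _ : Fin (k i) => empiricalMeasure (z i)).real
        {y | √(k i : ℝ) • (A i *ᵥ (sampleMean y - sampleMean (z i))) ≤ x}) l
      (𝓝 ((Measure.pi fun _ : Fin q => gaussianReal 0 1).real (Set.Iic x))) := by
  obtain ⟨hS, hm, h3⟩ := tendsto_zero_of_sampleDiscrepancy h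
  refine tendsto_pi_sampleMean hk A _ _ (fun t i => integrable_empiricalMeasure _ _)
    (fun t i => integral_dotProduct_empiricalMeasure_eq_zero t _ _) (fun t => ?_) (fun t => ?_) x
  · simp only [integral_sq_dotProduct_empiricalMeasure]
    have h1 : Tendsto (fun i => ∑ a, ∑ b, t a * t b *
        ((k i : ℝ)⁻¹ * ∑ j, (A i *ᵥ z i j) a * (A i *ᵥ z i j) b)) l (𝓝 (t ⬝ᵥ t)) := by
      have e : t ⬝ᵥ t = ∑ a, ∑ b, t a * t b * (1 : Matrix (Fin q) (Fin q) ℝ) a b := by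
        simp [dotProduct, Matrix.one_apply]
      rw [e]
      exact tendsto_finsetSum _ fun a _ => tendsto_finsetSum _ fun b _ => (hS a b).const_mul _
    have h2 : Tendsto (fun i => t ⬝ᵥ (A i *ᵥ sampleMean (z i))) l (𝓝 0) := by
      have hc : Continuous fun u : Fin q → ℝ => t ⬝ᵥ u := by fun_prop
      simpa [Function.comp_def] using (hc.tendsto 0).comp hm
    simpa using h1.sub (h2.pow 2)
  · have hb : Tendsto (fun i => 4 * (∑ a, |t a|) ^ 3 *
        (((k i : ℝ)⁻¹ * ∑ j, ‖A i *ᵥ z i j‖ ^ 3) / √(k i : ℝ)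
          + ‖A i *ᵥ sampleMean (z i)‖ ^ 3 / √(k i : ℝ))) l (𝓝 0) := by
      have hs : Tendsto (fun i => √(k i : ℝ)) l atTop :=
        Real.tendsto_sqrt_atTop.comp (tendsto_natCast_atTop_atTop.comp hk)
      have := (h3.add ((hm.norm.pow 3).div_atTop hs)).const_mul (4 * (∑ a, |t a|) ^ 3)
      simpa using this
    refine squeeze_zero (fun i => ?_) (fun i => ?_) hb
    · exact div_nonneg (integral_nonneg fun _ => by positivity) (Real.sqrt_nonneg _)
    · rw [← add_div, mul_div_assoc']
      gcongr
      exact integral_abs_dotProduct_pow_empiricalMeasure_le t _ _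

end Bootstrap

/-! ### Moments and covariance of a random vector. -/

section Moments
variable {Ω : Type*} [MeasurableSpace Ω] {μ : Measure Ω} {q : ℕ}

theorem norm_pow_le_sum_abs_pow (y : Fin q → ℝ) {p : ℕ} (hp : p ≠ 0) :
    ‖y‖ ^ p ≤ ∑ j, |y j| ^ p := by
  rcases isEmpty_or_nonempty (Fin q) with h | h
  · simp [Subsingleton.elim y 0, hp]
  · obtain ⟨j, hj⟩ := Finite.exists_max fun j => |y j|
    have h1 : ‖y‖ ≤ |y j| := (pi_norm_le_iff_of_nonneg (abs_nonneg _)).2 hj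
    exact (pow_le_pow_left₀ (norm_nonneg _) h1 p).trans
      (Finset.single_le_sum (f := fun j => |y j| ^ p) (fun _ _ => by positivity)
        (Finset.mem_univ j))

theorem exists_forall_integral_norm_pow_le {ξ : ℕ → Ω → Fin q → ℝ} (hξ : ∀ n, Measurable (ξ n))
    {p : ℕ} (hp : p ≠ 0) (h : ∀ j : Fin q, (⨆ n, ∫⁻ ω, ‖ξ n ω j‖ₑ ^ p ∂μ) < ∞) :
    ∃ K, ∀ n, Integrable (fun ω => ‖ξ n ω‖ ^ p) μ ∧ ∫ ω, ‖ξ n ω‖ ^ p ∂μ ≤ K := by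
  refine ⟨∑ j, (⨆ n, ∫⁻ ω, ‖ξ n ω j‖ₑ ^ p ∂μ).toReal, fun n => ?_⟩
  have hm (j : Fin q) : Measurable fun ω => ξ n ω j := (measurable_pi_apply j).comp (hξ n)
  have hle (j : Fin q) : ∫⁻ ω, ‖ξ n ω j‖ₑ ^ p ∂μ ≤ ⨆ n, ∫⁻ ω, ‖ξ n ω j‖ₑ ^ p ∂μ :=
    le_iSup (fun n => ∫⁻ ω, ‖ξ n ω j‖ₑ ^ p ∂μ) n
  have hi (j : Fin q) : Integrable (fun ω => ξ n ω j ^ p) μ :=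
    ⟨((hm j).pow_const p).aestronglyMeasurable, by
      simpa [HasFiniteIntegral, enorm_pow] using (hle j).trans_lt (h j)⟩
  have hi' (j : Fin q) : Integrable (fun ω => |ξ n ω j| ^ p) μ := by
    simpa [abs_pow] using (hi j).abs
  have hsum : Integrable (fun ω => ∑ j, |ξ n ω j| ^ p) μ := integrable_finsetSum _ fun j _ => hi' j
  have hint : Integrable (fun ω => ‖ξ n ω‖ ^ p) μ :=
    hsum.mono' ((hξ n).norm.pow_const p).aestronglyMeasurable (ae_of_all _ fun ω => by
      simpa using norm_pow_le_sum_abs_pow (ξ n ω) hp)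
  refine ⟨hint, (integral_mono hint hsum fun ω => norm_pow_le_sum_abs_pow (ξ n ω) hp).trans ?_⟩
  rw [integral_finsetSum _ fun j _ => hi' j]
  refine Finset.sum_le_sum fun j _ => ?_
  have e : ∫ ω, |ξ n ω j| ^ p ∂μ = (∫⁻ ω, ‖ξ n ω j‖ₑ ^ p ∂μ).toReal := by
    have := integral_norm_eq_lintegral_enorm (hi j).1
    simpa [abs_pow, enorm_pow] using this
  rw [e]
  exact ENNReal.toReal_mono (h j).ne (hle j)

variable {X : Ω → Fin q → ℝ}

theorem memLp_two_dotProduct (hX : Measurable X) (h : Integrable (fun ω => ‖X ω‖ ^ 2) μ)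
    (u : Fin q → ℝ) : MemLp (fun ω => u ⬝ᵥ X ω) 2 μ := by
  have hm : Measurable fun ω => u ⬝ᵥ X ω :=
    (show Continuous fun y : Fin q → ℝ => u ⬝ᵥ y by fun_prop).measurable.comp hX
  refine (memLp_two_iff_integrable_sq hm.aestronglyMeasurable).2
    ((h.const_mul ((∑ a, |u a|) ^ 2)).mono' (hm.pow_const 2).aestronglyMeasurable
      (ae_of_all _ fun ω => ?_))
  rw [norm_pow, ← mul_pow]
  exact pow_le_pow_left₀ (norm_nonneg _) (abs_dotProduct_le u (X ω)) 2

theorem integrable_norm_mulVec_pow (A : Matrix (Fin q) (Fin q) ℝ) (hX : Measurable X) {p : ℕ}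
    (h : Integrable (fun ω => ‖X ω‖ ^ p) μ) : Integrable (fun ω => ‖A *ᵥ X ω‖ ^ p) μ := by
  have hc : Continuous fun y : Fin q → ℝ => A *ᵥ y := by fun_prop
  refine (h.const_mul (‖A.mulVecLin.toContinuousLinearMap‖ ^ p)).mono'
    ((hc.measurable.comp hX).norm.pow_const p).aestronglyMeasurable (ae_of_all _ fun ω => ?_)
  rw [norm_pow, norm_norm, ← mul_pow]
  exact pow_le_pow_left₀ (norm_nonneg _) (A.mulVecLin.toContinuousLinearMap.le_opNorm (X ω)) p

theorem covMatrix_isHermitian (X : Ω → Fin q → ℝ) (μ : Measure Ω) :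
    (covMatrix X μ).IsHermitian := by
  ext a b
  simp [covMatrix, covariance_comm]

variable [IsProbabilityMeasure μ]

theorem integrable_norm_pow_of_le {m p : ℕ} (hmp : m ≤ p) (hX : Measurable X)
    (h : Integrable (fun ω => ‖X ω‖ ^ p) μ) : Integrable (fun ω => ‖X ω‖ ^ m) μ :=
  integrable_pow_of_integrable_abs_pow hmp hX.norm (by simpa using h)

theorem integral_norm_pow_le_one_add {m p : ℕ} (hmp : m ≤ p) (hX : Measurable X)
    (h : Integrable (fun ω => ‖X ω‖ ^ p) μ) :
    ∫ ω, ‖X ω‖ ^ m ∂μ ≤ 1 + ∫ ω, ‖X ω‖ ^ p ∂μ := by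
  have e : 1 + ∫ ω, ‖X ω‖ ^ p ∂μ = ∫ ω, (1 + ‖X ω‖ ^ p) ∂μ := by
    rw [integral_add (integrable_const _) h]; simp
  rw [e]
  refine integral_mono (integrable_norm_pow_of_le hmp hX h) ((integrable_const _).add h)
    fun ω => ?_
  rcases le_total ‖X ω‖ 1 with h1 | h1
  · have := pow_le_one₀ (n := m) (norm_nonneg (X ω)) h1
    have := pow_nonneg (norm_nonneg (X ω)) p
    simp only
    linarith
  · have := pow_le_pow_right₀ h1 hmp
    simp only
    linarith

theorem integral_dotProduct_eq_zero (hX : Measurable X) (h : Integrable (fun ω => ‖X ω‖ ^ 2) μ)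
    (h0 : ∫ ω, X ω ∂μ = 0) (u : Fin q → ℝ) : ∫ ω, u ⬝ᵥ X ω ∂μ = 0 := by
  have hi (a : Fin q) : Integrable (fun ω => X ω a) μ := by
    simpa using (memLp_two_dotProduct hX h (Pi.single a 1)).integrable (by norm_num)
  simp only [dotProduct]
  rw [integral_finsetSum _ fun a _ => (hi a).const_mul _]
  refine Finset.sum_eq_zero fun a _ => ?_
  rw [integral_const_mul, ← eval_integral hi, h0]
  simp

theorem integral_dotProduct_mul_dotProduct (hX : Measurable X)
    (h : Integrable (fun ω => ‖X ω‖ ^ 2) μ) (h0 : ∫ ω, X ω ∂μ = 0) (u v : Fin q → ℝ) :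
    ∫ ω, (u ⬝ᵥ X ω) * (v ⬝ᵥ X ω) ∂μ = u ⬝ᵥ (covMatrix X μ *ᵥ v) := by
  have hm (a : Fin q) : MemLp (fun ω => X ω a) 2 μ := by
    simpa using memLp_two_dotProduct hX h (Pi.single a 1)
  have hz (a : Fin q) : ∫ ω, X ω a ∂μ = 0 := by
    simpa using integral_dotProduct_eq_zero hX h h0 (Pi.single a 1)
  have hc (a b : Fin q) : covMatrix X μ a b = ∫ ω, X ω a * X ω b ∂μ := by
    simp [covMatrix, covariance, hz]
  have hi (a b : Fin q) : Integrable (fun ω => X ω a * X ω b) μ := (hm a).integrable_mul (hm b)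
  have e (ω : Ω) : (u ⬝ᵥ X ω) * (v ⬝ᵥ X ω) = ∑ a, ∑ b, u a * v b * (X ω a * X ω b) := by
    rw [dotProduct, dotProduct, Finset.sum_mul_sum]
    exact Finset.sum_congr rfl fun a _ => Finset.sum_congr rfl fun b _ => by ring
  simp only [e]
  rw [integral_finsetSum _ fun a _ => integrable_finsetSum _ fun b _ => (hi a b).const_mul _]
  simp only [dotProduct, Matrix.mulVec, Finset.mul_sum]
  refine Finset.sum_congr rfl fun a _ => ?_
  rw [integral_finsetSum _ fun b _ => (hi a b).const_mul _]
  refine Finset.sum_congr rfl fun b _ => ?_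
  rw [integral_const_mul, hc]
  ring

end Moments

/-! ### Variance bounds for averages and the expected discrepancy. -/

section Averages
variable {Ω : Type*} [MeasurableSpace Ω] {μ : Measure Ω} [IsProbabilityMeasure μ] {q k : ℕ}
  [NeZero k]

theorem integral_sq_average_sub_le {X : Fin k → Ω → ℝ} (hind : iIndepFun X μ)
    (hid : ∀ i, IdentDistrib (X i) (X 0) μ μ) (h2 : MemLp (X 0) 2 μ) :
    Integrable (fun ω => ((k : ℝ)⁻¹ * ∑ i, X i ω - ∫ ω, X 0 ω ∂μ) ^ 2) μ ∧
      ∫ ω, ((k : ℝ)⁻¹ * ∑ i, X i ω - ∫ ω, X 0 ω ∂μ) ^ 2 ∂μ ≤ (∫ ω, X 0 ω ^ 2 ∂μ) / k := by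
  have hk : (k : ℝ) ≠ 0 := Nat.cast_ne_zero.2 (NeZero.ne k)
  have hL (i : Fin k) : MemLp (X i) 2 μ := (hid i).symm.memLp_snd h2
  have hS : MemLp (∑ i, X i) 2 μ := memLp_finsetSum' _ fun i _ => hL i
  have hY : MemLp (fun ω => (k : ℝ)⁻¹ * (∑ i, X i) ω) 2 μ := hS.const_mul _
  have hmean : ∫ ω, (k : ℝ)⁻¹ * (∑ i, X i) ω ∂μ = ∫ ω, X 0 ω ∂μ := by
    simp only [Finset.sum_apply]
    rw [integral_const_mul, integral_finsetSum _ fun i _ => (hL i).integrable (by norm_num)]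
    simp [fun i => (hid i).integral_eq, hk]
  have hvar : ∫ ω, ((k : ℝ)⁻¹ * (∑ i, X i) ω - ∫ ω, X 0 ω ∂μ) ^ 2 ∂μ = Var[X 0; μ] / k := by
    rw [← hmean, ← variance_eq_integral hY.1.aemeasurable, variance_const_mul,
      IndepFun.variance_sum (fun i _ => hL i) fun i _ j _ hij => hind.indepFun hij]
    simp [fun i => (hid i).variance_eq]
    field_simp
  have hint : Integrable (fun ω => ((k : ℝ)⁻¹ * (∑ i, X i) ω - ∫ ω, X 0 ω ∂μ) ^ 2) μ :=
    (hY.sub (memLp_const _)).integrable_sq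
  simp only [Finset.sum_apply] at hvar hint
  refine ⟨hint, ?_⟩
  rw [hvar]
  gcongr
  exact variance_le_expectation_sq h2.1

/-- The first two parts of the discrepancy are squared deviations of averages, of expectation at
most a second moment over `k`. For the products of coordinates that second moment is where fourth
moments are needed. The last part only requires a bounded third moment. -/
theorem integral_sampleDiscrepancy_one_le {η : Fin k → Ω → Fin q → ℝ}
    (hη : ∀ i, Measurable (η i)) (hind : iIndepFun η μ)
    (hid : ∀ i, IdentDistrib (η i) (η 0) μ μ) (h4 : Integrable (fun ω => ‖η 0 ω‖ ^ 4) μ)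
    (h0 : ∀ a, ∫ ω, η 0 ω a ∂μ = 0)
    (h1 : ∀ a b, ∫ ω, η 0 ω a * η 0 ω b ∂μ = (1 : Matrix (Fin q) (Fin q) ℝ) a b) :
    Integrable (fun ω => sampleDiscrepancy 1 fun i => η i ω) μ ∧
      ∫ ω, sampleDiscrepancy 1 (fun i => η i ω) ∂μ
        ≤ (q * (q * ((1 + ∫ ω, ‖η 0 ω‖ ^ 4 ∂μ) / k)) + q * ((1 + ∫ ω, ‖η 0 ω‖ ^ 4 ∂μ) / k))
          + (1 + ∫ ω, ‖η 0 ω‖ ^ 4 ∂μ) / √(k : ℝ) := by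
  have hk : (k : ℝ) ≠ 0 := Nat.cast_ne_zero.2 (NeZero.ne k)
  set K := ∫ ω, ‖η 0 ω‖ ^ 4 ∂μ with hK
  have happ (a : Fin q) : Measurable fun ω => η 0 ω a := (measurable_pi_apply a).comp (hη 0)
  have h2 := integrable_norm_pow_of_le (m := 2) (by norm_num) (hη 0) h4
  have hle2 : ∫ ω, ‖η 0 ω‖ ^ 2 ∂μ ≤ 1 + K :=
    integral_norm_pow_le_one_add (by norm_num) (hη 0) h4
  have hle3 : ∫ ω, ‖η 0 ω‖ ^ 3 ∂μ ≤ 1 + K :=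
    integral_norm_pow_le_one_add (by norm_num) (hη 0) h4
  have b1 (a : Fin q) (ω : Ω) : |η 0 ω a| ^ 2 ≤ ‖η 0 ω‖ ^ 2 :=
    pow_le_pow_left₀ (abs_nonneg _) (norm_le_pi_norm (η 0 ω) a) 2
  have b2 (a b : Fin q) (ω : Ω) : |η 0 ω a * η 0 ω b| ^ 2 ≤ ‖η 0 ω‖ ^ 4 := by
    rw [abs_mul, mul_pow, show ‖η 0 ω‖ ^ 4 = ‖η 0 ω‖ ^ 2 * ‖η 0 ω‖ ^ 2 by ring]
    exact mul_le_mul (b1 a ω) (b1 b ω) (by positivity) (by positivity)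
  have hA (a b : Fin q) := integral_sq_average_sub_le (μ := μ)
    (X := fun (i : Fin k) ω => η i ω a * η i ω b)
    (hind.comp (fun _ y => y a * y b) fun _ => by fun_prop)
    (fun i => (hid i).comp (u := fun y : Fin q → ℝ => y a * y b) (by fun_prop))
    ((memLp_two_iff_integrable_sq ((happ a).mul (happ b)).aestronglyMeasurable).2
      (h4.mono' (((happ a).mul (happ b)).pow_const 2).aestronglyMeasurable
        (ae_of_all _ fun ω => by
          rw [norm_pow]; exact b2 a b ω)))
  have hB (a : Fin q) := integral_sq_average_sub_le (μ := μ)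
    (X := fun (i : Fin k) ω => η i ω a)
    (hind.comp (fun _ y => y a) fun _ => by fun_prop)
    (fun i => (hid i).comp (u := fun y : Fin q → ℝ => y a) (by fun_prop))
    ((memLp_two_iff_integrable_sq (happ a).aestronglyMeasurable).2
      (h2.mono' ((happ a).pow_const 2).aestronglyMeasurable
        (ae_of_all _ fun ω => by
          rw [norm_pow]; exact b1 a ω)))
  simp only [h1] at hA
  simp only [h0, sub_zero] at hB
  have i3 : Integrable (fun ω => ‖η 0 ω‖ ^ 3) μ :=
    integrable_norm_pow_of_le (by norm_num) (hη 0) h4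
  have hid3 (i : Fin k) : IdentDistrib (fun ω => ‖η i ω‖ ^ 3) (fun ω => ‖η 0 ω‖ ^ 3) μ μ :=
    (hid i).comp (u := fun y : Fin q → ℝ => ‖y‖ ^ 3) (by fun_prop)
  have i3' (i : Fin k) : Integrable (fun ω => ‖η i ω‖ ^ 3) μ := (hid3 i).integrable_iff.2 i3
  have iA : Integrable (fun ω => ∑ a, ∑ b, ((k : ℝ)⁻¹ * ∑ i, η i ω a * η i ω b
      - (1 : Matrix (Fin q) (Fin q) ℝ) a b) ^ 2) μ :=
    integrable_finsetSum _ fun a _ => integrable_finsetSum _ fun b _ => (hA a b).1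
  have iB : Integrable (fun ω => ∑ a, ((k : ℝ)⁻¹ * ∑ i, η i ω a) ^ 2) μ :=
    integrable_finsetSum _ fun a _ => (hB a).1
  have iC : Integrable (fun ω => ((k : ℝ)⁻¹ * ∑ i, ‖η i ω‖ ^ 3) / √(k : ℝ)) μ :=
    ((integrable_finsetSum _ fun i _ => i3' i).const_mul _).div_const _
  have iAB : Integrable (fun ω => (∑ a, ∑ b, ((k : ℝ)⁻¹ * ∑ i, η i ω a * η i ω b
      - (1 : Matrix (Fin q) (Fin q) ℝ) a b) ^ 2) + ∑ a, ((k : ℝ)⁻¹ * ∑ i, η i ω a) ^ 2) μ :=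
    iA.add iB
  simp only [sampleDiscrepancy, Matrix.one_mulVec]
  refine ⟨iAB.add iC, ?_⟩
  rw [integral_add iAB iC, integral_add iA iB]
  gcongr ?_ + ?_ + ?_
  · rw [integral_finsetSum _ fun a _ => integrable_finsetSum _ fun b _ => (hA a b).1]
    refine (Finset.sum_le_card_nsmul _ _ (q * ((1 + K) / k)) fun a _ => ?_).trans (by simp)
    rw [integral_finsetSum _ fun b _ => (hA a b).1]
    refine (Finset.sum_le_card_nsmul _ _ ((1 + K) / k) fun b _ => ?_).trans (by simp)
    refine (hA a b).2.trans ?_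
    gcongr
    have : ∫ ω, (η 0 ω a * η 0 ω b) ^ 2 ∂μ ≤ K := by
      refine integral_mono_of_nonneg (ae_of_all _ fun ω => sq_nonneg _) h4
        (ae_of_all _ fun ω => ?_)
      have := b2 a b ω
      rwa [sq_abs] at this
    linarith
  · rw [integral_finsetSum _ fun a _ => (hB a).1]
    refine (Finset.sum_le_card_nsmul _ _ ((1 + K) / k) fun a _ => ?_).trans (by simp)
    refine (hB a).2.trans ?_
    gcongr
    refine le_trans (integral_mono_of_nonneg (ae_of_all _ fun ω => sq_nonneg _) h2
        (ae_of_all _ fun ω => ?_)) hle2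
    have := b1 a ω
    rwa [sq_abs] at this
  · rw [integral_div, integral_const_mul, integral_finsetSum _ fun i _ => i3' i]
    simp only [fun i => (hid3 i).integral_eq]
    simp only [Finset.sum_const, Finset.card_univ, Fintype.card_fin, nsmul_eq_mul,
      inv_mul_cancel_left₀ hk]
    gcongr

end Averages

/-! ### Uniform nondegeneracy of the covariance matrices. -/

section LowerBound
variable {Ω : Type*} [MeasurableSpace Ω] {μ : Measure Ω} [IsProbabilityMeasure μ] {q : ℕ}

/-- The liminf hypothesis is pointwise in `v`. Bounded second moments make the quadratic forms
equicontinuous, so a bound at one direction extends to a neighbourhood; compactness of the sphere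
and homogeneity do the rest. -/
theorem exists_forall_mul_sq_norm_le_covMatrix {ξ : ℕ → Ω → Fin q → ℝ}
    (hξ : ∀ n, Measurable (ξ n)) (h0 : ∀ n, ∫ ω, ξ n ω ∂μ = 0) {K : ℝ}
    (h2 : ∀ n, Integrable (fun ω => ‖ξ n ω‖ ^ 2) μ) (hK : ∀ n, ∫ ω, ‖ξ n ω‖ ^ 2 ∂μ ≤ K)
    {Γ : Matrix (Fin q) (Fin q) ℝ} (hΓ : Γ.PosDef)
    (hl : IsLiminfLowerBound Γ fun n => covMatrix (ξ n) μ) :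
    ∃ c > 0, ∀ᶠ n in atTop, ∀ v : Fin q → ℝ, c * ‖v‖ ^ 2 ≤ v ⬝ᵥ (covMatrix (ξ n) μ *ᵥ v) := by
  have hQ (n : ℕ) (v : Fin q → ℝ) :
      v ⬝ᵥ (covMatrix (ξ n) μ *ᵥ v) = ∫ ω, (v ⬝ᵥ ξ n ω) ^ 2 ∂μ := by
    rw [← integral_dotProduct_mul_dotProduct (hξ n) (h2 n) (h0 n)]
    simp only [sq]
  have hi (n : ℕ) (v : Fin q → ℝ) : Integrable (fun ω => (v ⬝ᵥ ξ n ω) ^ 2) μ :=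
    (memLp_two_dotProduct (hξ n) (h2 n) v).integrable_sq
  have hup (n : ℕ) (v : Fin q → ℝ) : ∫ ω, (v ⬝ᵥ ξ n ω) ^ 2 ∂μ ≤ (∑ a, |v a|) ^ 2 * K := by
    refine le_trans ?_ (mul_le_mul_of_nonneg_left (hK n) (sq_nonneg _))
    rw [← integral_const_mul]
    refine integral_mono (hi n v) ((h2 n).const_mul _) fun ω => ?_
    simp only
    rw [← mul_pow, ← sq_abs]
    exact pow_le_pow_left₀ (abs_nonneg _) (abs_dotProduct_le _ _) 2
  have hcompare (n : ℕ) (v w : Fin q → ℝ) : ∫ ω, (w ⬝ᵥ ξ n ω) ^ 2 ∂μ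
      ≤ 2 * ∫ ω, (v ⬝ᵥ ξ n ω) ^ 2 ∂μ + 2 * ∫ ω, ((w - v) ⬝ᵥ ξ n ω) ^ 2 ∂μ := by
    rw [← integral_const_mul, ← integral_const_mul,
      ← integral_add ((hi n v).const_mul 2) ((hi n _).const_mul 2)]
    refine integral_mono (hi n w) (((hi n v).const_mul 2).add ((hi n _).const_mul 2)) fun ω => ?_
    simp only [sub_dotProduct]
    nlinarith [sq_nonneg (v ⬝ᵥ ξ n ω - (w ⬝ᵥ ξ n ω - v ⬝ᵥ ξ n ω))]
  have hsphere : ∃ c > 0, ∀ᶠ n in atTop, ∀ v ∈ Metric.sphere (0 : Fin q → ℝ) 1,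
      c ≤ ∫ ω, (v ⬝ᵥ ξ n ω) ^ 2 ∂μ := by
    refine (isCompact_sphere (0 : Fin q → ℝ) 1).induction_on
      (p := fun S => ∃ c > 0, ∀ᶠ n in atTop, ∀ v ∈ S, c ≤ ∫ ω, (v ⬝ᵥ ξ n ω) ^ 2 ∂μ)
      ⟨1, one_pos, by simp⟩ ?_ ?_ ?_
    · rintro s t hst ⟨c, hc, h⟩
      exact ⟨c, hc, h.mono fun n hn v hv => hn v (hst hv)⟩
    · rintro s t ⟨c, hc, h⟩ ⟨d, hd, h'⟩
      refine ⟨min c d, lt_min hc hd, ?_⟩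
      filter_upwards [h, h'] with n hn hn' v hv
      exact hv.elim (fun hv => (min_le_left _ _).trans (hn v hv))
        fun hv => (min_le_right _ _).trans (hn' v hv)
    · intro w hw
      have hw0 : w ≠ 0 := by
        rintro rfl
        simp at hw
      have hpos : 0 < w ⬝ᵥ (Γ *ᵥ w) := by simpa using hΓ.dotProduct_mulVec_pos hw0
      set c := w ⬝ᵥ (Γ *ᵥ w)
      have hev : ∀ᶠ n in atTop, c / 2 < ∫ ω, (w ⬝ᵥ ξ n ω) ^ 2 ∂μ := by
        have h1 : c / 2 < liminf (fun n => ∫ ω, (w ⬝ᵥ ξ n ω) ^ 2 ∂μ) atTop := by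
          have := hl w
          simp only [hQ] at this
          exact (half_lt_self hpos).trans_le this
        -- A real `liminf` is informative only for sequences bounded below; here nonnegativity
        -- suffices.
        exact eventually_lt_of_lt_liminf h1 (isBoundedUnder_of_eventually_ge
          (Eventually.of_forall fun n => integral_nonneg fun ω => sq_nonneg _))
      have hnear : ∀ᶠ v in 𝓝 w, (∑ a, |(w - v) a|) ^ 2 * K < c / 8 := by
        have hc : Continuous fun v : Fin q → ℝ => (∑ a, |(w - v) a|) ^ 2 * K := by fun_prop
        refine (hc.tendsto w).eventually_lt_const ?_
        simp
        linarith
      -- By `hcompare`, `c/2 < 2 Q(v) + 2 · c/8` for the quadratic form `Q`, hence `Q(v) > c/8`.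
      refine ⟨_, mem_nhdsWithin_of_mem_nhds hnear, c / 8, by positivity, ?_⟩
      filter_upwards [hev] with n hn v hv
      have h1 := hcompare n v w
      have h2 := hup n (w - v)
      have h3 : (∑ a, |(w - v) a|) ^ 2 * K < c / 8 := hv
      linarith
  obtain ⟨c, hc, h⟩ := hsphere
  refine ⟨c, hc, h.mono fun n hn v => ?_⟩
  rw [hQ]
  rcases eq_or_ne v 0 with rfl | hv
  · simp
  have hv' : ‖v‖ ≠ 0 := norm_ne_zero_iff.2 hv
  have := hn (‖v‖⁻¹ • v) (by simp [norm_smul, hv'])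
  simp only [smul_dotProduct, smul_eq_mul, mul_pow] at this
  rw [integral_const_mul, inv_pow, ← div_eq_inv_mul, le_div_iff₀ (by positivity)] at this
  exact this

/-- The lower bound is evaluated at `A w`, where the quadratic form of `M` collapses to `w ⬝ᵥ w`.
The factor `q` compares the Euclidean norm with the sup norm. -/
theorem mul_sq_norm_mulVec_le {A M : Matrix (Fin q) (Fin q) ℝ} (hA : Aᵀ = A)
    (hAMA : A * M * A = 1) {c : ℝ} (hM : ∀ v : Fin q → ℝ, c * ‖v‖ ^ 2 ≤ v ⬝ᵥ (M *ᵥ v))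
    (w : Fin q → ℝ) : c * ‖A *ᵥ w‖ ^ 2 ≤ q * ‖w‖ ^ 2 := by
  refine (hM _).trans ?_
  have e : (A *ᵥ w) ⬝ᵥ (M *ᵥ (A *ᵥ w)) = w ⬝ᵥ w := by
    rw [← Matrix.vecMul_transpose, hA, ← Matrix.dotProduct_mulVec, Matrix.mulVec_mulVec,
      ← Matrix.mulVec_transpose, hA, Matrix.mulVec_mulVec, hAMA, Matrix.one_mulVec]
  rw [e, dotProduct]
  refine (Finset.sum_le_card_nsmul _ _ (‖w‖ ^ 2) fun a _ => ?_).trans (by simp)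
  rw [← sq, ← sq_abs]
  exact pow_le_pow_left₀ (abs_nonneg _) (norm_le_pi_norm w a) 2

end LowerBound

/-! ### Conditional law, standardised arrays and uniformity in the sample. -/

section Standardization
variable {Ω : Type*} [MeasurableSpace Ω] {μ : Measure Ω} [IsProbabilityMeasure μ] {q : ℕ}

@[fun_prop]
theorem continuous_sampleMean {k q : ℕ} :
    Continuous (sampleMean : (Fin k → Fin q → ℝ) → Fin q → ℝ) := by
  unfold sampleMean
  fun_prop

/-- The event depends on the pair `(X, Xs)`; disintegration freezes `X` and integrates `Xs` against
its conditional law. -/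
theorem condExp_bootstrap_ae_eq {k : ℕ} {X Xs : Ω → Fin k → Fin q → ℝ} (hX : Measurable X)
    (hboot : IsBootstrapVersion Xs X μ) (A : Matrix (Fin q) (Fin q) ℝ) (x : Fin q → ℝ) :
    μ⟦{ω | √(k : ℝ) • (A *ᵥ (sampleMean (Xs ω) - sampleMean (X ω))) ≤ x} |
        MeasurableSpace.comap X inferInstance⟧
      =ᵐ[μ] fun ω => (Measure.pi fun _ : Fin k => empiricalMeasure (X ω)).real
        {y | √(k : ℝ) • (A *ᵥ (sampleMean y - sampleMean (X ω))) ≤ x} := by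
  let S : Set ((Fin k → Fin q → ℝ) × (Fin k → Fin q → ℝ)) :=
    {p | √(k : ℝ) • (A *ᵥ (sampleMean p.2 - sampleMean p.1)) ≤ x}
  have hc : Continuous fun p : (Fin k → Fin q → ℝ) × (Fin k → Fin q → ℝ) =>
      √(k : ℝ) • (A *ᵥ (sampleMean p.2 - sampleMean p.1)) := by
    fun_prop
  have hS : MeasurableSet S := (isClosed_Iic.preimage hc).measurableSet
  have hXs := hboot.1
  have hf : StronglyMeasurable (S.indicator fun _ => (1 : ℝ)) :=
    stronglyMeasurable_const.indicator hS
  have key := condExp_prod_ae_eq_integral_condDistrib hX hXs.aemeasurable hf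
    ((integrable_const (1 : ℝ)).indicator ((hX.prodMk hXs) hS) :
      Integrable (((fun ω => (X ω, Xs ω)) ⁻¹' S).indicator fun _ => (1 : ℝ)) μ)
  refine key.trans ?_
  filter_upwards [ae_of_ae_map hX.aemeasurable hboot.2] with ω hω
  rw [hω]
  have hSω : MeasurableSet {y | √(k : ℝ) • (A *ᵥ (sampleMean y - sampleMean (X ω))) ≤ x} :=
    measurable_prodMk_left hS
  rw [← integral_indicator_one hSω]
  rfl

theorem tendsto_measureReal_sampleMean {k : ℕ → ℕ} [∀ n, NeZero (k n)]
    (hk : Tendsto k atTop atTop) {ξ : ∀ n, Fin (k n) → Ω → Fin q → ℝ}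
    (hmeas : ∀ n i, Measurable (ξ n i)) (hindep : ∀ n, iIndepFun (ξ n) μ)
    (hident : ∀ n i, IdentDistrib (ξ n i) (ξ n 0) μ μ) (hmean : ∀ n, ∫ ω, ξ n 0 ω ∂μ = 0)
    {A : ℕ → Matrix (Fin q) (Fin q) ℝ} (hA : ∀ n, (A n)ᵀ = A n)
    (hstd : ∀ᶠ n in atTop, A n * covMatrix (ξ n 0) μ * A n = 1)
    (h4 : ∀ n, Integrable (fun ω => ‖ξ n 0 ω‖ ^ 4) μ) {K : ℝ}
    (hK : ∀ᶠ n in atTop, ∫ ω, ‖A n *ᵥ ξ n 0 ω‖ ^ 4 ∂μ ≤ K) (x : Fin q → ℝ) :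
    Tendsto (fun n => μ.real {ω | √(k n : ℝ) • (A n *ᵥ sampleMean fun i => ξ n i ω) ≤ x}) atTop
      (𝓝 ((Measure.pi fun _ : Fin q => gaussianReal 0 1).real (Set.Iic x))) := by
  have hcA (n : ℕ) : Continuous fun y : Fin q → ℝ => A n *ᵥ y := by fun_prop
  have hct (n : ℕ) (t : Fin q → ℝ) : Continuous fun y : Fin q → ℝ => t ⬝ᵥ (A n *ᵥ y) :=
    continuous_const.dotProduct (hcA n)
  have hc2 (n : ℕ) (t : Fin q → ℝ) : Continuous fun y : Fin q → ℝ => (t ⬝ᵥ (A n *ᵥ y)) ^ 2 :=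
    (hct n t).pow 2
  have hc3 (n : ℕ) (t : Fin q → ℝ) : Continuous fun y : Fin q → ℝ => |t ⬝ᵥ (A n *ᵥ y)| ^ 3 :=
    (hct n t).abs.pow 3
  have h2 n := integrable_norm_pow_of_le (m := 2) (by norm_num) (hmeas n 0) (h4 n)
  have hrow (n : ℕ) (t y : Fin q → ℝ) : t ⬝ᵥ (A n *ᵥ y) = (A n *ᵥ t) ⬝ᵥ y := by
    rw [Matrix.dotProduct_mulVec, ← Matrix.mulVec_transpose, hA]
  have hA4 (n : ℕ) := integrable_norm_mulVec_pow (A n) (hmeas n 0) (h4 n)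
  have hmA (n : ℕ) : Measurable fun ω => A n *ᵥ ξ n 0 ω := (hcA n).measurable.comp (hmeas n 0)
  have hA3 (n : ℕ) := integrable_norm_pow_of_le (m := 3) (by norm_num) (hmA n) (hA4 n)
  have h3 (n : ℕ) (t : Fin q → ℝ) : Integrable (fun ω => |t ⬝ᵥ (A n *ᵥ ξ n 0 ω)| ^ 3) μ := by
    refine ((hA3 n).const_mul ((∑ a, |t a|) ^ 3)).mono'
      (((hct n t).measurable.comp (hmeas n 0)).norm.pow_const 3).aestronglyMeasurable
      (ae_of_all _ fun ω => ?_)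
    rw [← mul_pow, norm_pow, Real.norm_eq_abs, abs_abs]
    exact pow_le_pow_left₀ (abs_nonneg _) (abs_dotProduct_le _ _) 3
  let ρ (n : ℕ) : Measure (Fin q → ℝ) := μ.map (ξ n 0)
  have hρ (n : ℕ) : IsProbabilityMeasure (ρ n) :=
    Measure.isProbabilityMeasure_map (hmeas n 0).aemeasurable
  have hint (n : ℕ) {f : (Fin q → ℝ) → ℝ} (hf : Continuous f) :
      ∫ y, f y ∂(ρ n) = ∫ ω, f (ξ n 0 ω) ∂μ :=
    integral_map (hmeas n 0).aemeasurable hf.measurable.aestronglyMeasurable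
  have key := tendsto_pi_sampleMean hk A ρ 0 (fun t n => ?_) (fun t n => ?_) (fun t => ?_)
    (fun t => ?_) x
  · refine key.congr fun n => ?_
    -- Independence and identical distribution make the law of a row a power of `ρ n`.
    have hpi : (Measure.pi fun _ : Fin (k n) => ρ n) = μ.map fun ω i => ξ n i ω := by
      rw [(hindep n).map_fun_eq_pi_map fun i => (hmeas n i).aemeasurable]
      simp [ρ, fun i => (hident n i).map_eq]
    have hc : Continuous fun z : Fin (k n) → Fin q → ℝ =>
        √(k n : ℝ) • (A n *ᵥ (sampleMean z - (0 : ℕ → Fin q → ℝ) n)) := by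
      fun_prop
    rw [hpi, map_measureReal_apply (measurable_pi_lambda _ (hmeas n))
      (isClosed_le hc continuous_const).measurableSet]
    simp
  · refine (integrable_map_measure ?_ (hmeas n 0).aemeasurable).2 ?_
    · simpa using (hc3 n t).measurable.aestronglyMeasurable
    · simpa [Function.comp_def] using h3 n t
  · simp only [Pi.zero_apply, sub_zero]
    rw [hint n (hct n t)]
    simp only [hrow]
    exact integral_dotProduct_eq_zero (hmeas n 0) (h2 n) (hmean n) _
  · refine tendsto_const_nhds.congr' ?_
    filter_upwards [hstd] with n hn
    simp only [Pi.zero_apply, sub_zero]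
    rw [hint n (hc2 n t)]
    simp only [hrow, sq]
    rw [integral_dotProduct_mul_dotProduct (hmeas n 0) (h2 n) (hmean n), ← hrow,
      Matrix.mulVec_mulVec, Matrix.mulVec_mulVec, hn, Matrix.one_mulVec]
  · have hb : Tendsto (fun n => ((∑ a, |t a|) ^ 3 * (1 + K)) / √(k n : ℝ)) atTop (𝓝 0) :=
      tendsto_const_nhds.div_atTop
        (Real.tendsto_sqrt_atTop.comp (tendsto_natCast_atTop_atTop.comp hk))
    refine squeeze_zero' (Eventually.of_forall fun n =>
      div_nonneg (integral_nonneg fun _ => by positivity) (Real.sqrt_nonneg _)) ?_ hb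
    filter_upwards [hK] with n hn
    simp only [Pi.zero_apply, sub_zero]
    rw [hint n (hc3 n t)]
    gcongr
    calc ∫ ω, |t ⬝ᵥ (A n *ᵥ ξ n 0 ω)| ^ 3 ∂μ
        ≤ ∫ ω, (∑ a, |t a|) ^ 3 * ‖A n *ᵥ ξ n 0 ω‖ ^ 3 ∂μ := by
          refine integral_mono (h3 n t) ((hA3 n).const_mul _) fun ω => ?_
          simp only
          rw [← mul_pow]
          exact pow_le_pow_left₀ (abs_nonneg _) (abs_dotProduct_le _ _) 3
      _ ≤ (∑ a, |t a|) ^ 3 * (1 + K) := by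
          rw [integral_const_mul]
          gcongr
          exact (integral_norm_pow_le_one_add (by norm_num) (hmA n) (hA4 n)).trans (by linarith)

theorem tendsto_integral_sampleDiscrepancy {k : ℕ → ℕ} [∀ n, NeZero (k n)]
    (hk : Tendsto k atTop atTop) {ξ : ∀ n, Fin (k n) → Ω → Fin q → ℝ}
    (hmeas : ∀ n i, Measurable (ξ n i)) (hindep : ∀ n, iIndepFun (ξ n) μ)
    (hident : ∀ n i, IdentDistrib (ξ n i) (ξ n 0) μ μ) (hmean : ∀ n, ∫ ω, ξ n 0 ω ∂μ = 0)
    {A : ℕ → Matrix (Fin q) (Fin q) ℝ} (hA : ∀ n, (A n)ᵀ = A n)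
    (hstd : ∀ᶠ n in atTop, A n * covMatrix (ξ n 0) μ * A n = 1)
    (h4 : ∀ n, Integrable (fun ω => ‖ξ n 0 ω‖ ^ 4) μ) {K : ℝ}
    (hK : ∀ᶠ n in atTop, ∫ ω, ‖A n *ᵥ ξ n 0 ω‖ ^ 4 ∂μ ≤ K) :
    (∀ᶠ n in atTop, Integrable (fun ω => sampleDiscrepancy (A n) fun i => ξ n i ω) μ) ∧
      Tendsto (fun n => ∫ ω, sampleDiscrepancy (A n) (fun i => ξ n i ω) ∂μ) atTop (𝓝 0) := by
  have hcA (n : ℕ) : Continuous fun y : Fin q → ℝ => A n *ᵥ y := by fun_prop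
  have h2 n := integrable_norm_pow_of_le (m := 2) (by norm_num) (hmeas n 0) (h4 n)
  have hrow (n : ℕ) (a : Fin q) (y : Fin q → ℝ) :
      (A n *ᵥ y) a = (A n *ᵥ Pi.single a 1) ⬝ᵥ y := by
    rw [← single_one_dotProduct a (A n *ᵥ y), Matrix.dotProduct_mulVec,
      ← Matrix.mulVec_transpose, hA]
  have key : ∀ᶠ n in atTop, Integrable (fun ω => sampleDiscrepancy (A n) fun i => ξ n i ω) μ ∧
      ∫ ω, sampleDiscrepancy (A n) (fun i => ξ n i ω) ∂μ
        ≤ (q * (q * ((1 + K) / k n)) + q * ((1 + K) / k n)) + (1 + K) / √(k n : ℝ) := by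
    filter_upwards [hstd, hK] with n hn hKn
    have := integral_sampleDiscrepancy_one_le (μ := μ) (η := fun i ω => A n *ᵥ ξ n i ω)
      (fun i => (hcA n).measurable.comp (hmeas n i))
      ((hindep n).comp (fun _ y => A n *ᵥ y) fun _ => (hcA n).measurable)
      (fun i => (hident n i).comp (hcA n).measurable)
      (integrable_norm_mulVec_pow (A n) (hmeas n 0) (h4 n))
      (fun a => by
        simp only [hrow]
        exact integral_dotProduct_eq_zero (hmeas n 0) (h2 n) (hmean n) _)
      (fun a b => by
        simp only [hrow]
        rw [integral_dotProduct_mul_dotProduct (hmeas n 0) (h2 n) (hmean n), ← hrow,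
          Matrix.mulVec_mulVec, Matrix.mulVec_mulVec, hn]
        simp)
    simp only [sampleDiscrepancy_eq (A n)]
    refine ⟨this.1, this.2.trans ?_⟩
    gcongr
  have hkR : Tendsto (fun n => (k n : ℝ)) atTop atTop := tendsto_natCast_atTop_atTop.comp hk
  have l1 : Tendsto (fun n => (1 + K) / (k n : ℝ)) atTop (𝓝 0) :=
    tendsto_const_nhds.div_atTop hkR
  have l2 : Tendsto (fun n => (1 + K) / √(k n : ℝ)) atTop (𝓝 0) :=
    tendsto_const_nhds.div_atTop (Real.tendsto_sqrt_atTop.comp hkR)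
  have hb := (((l1.const_mul (q : ℝ)).const_mul (q : ℝ)).add (l1.const_mul (q : ℝ))).add l2
  simp only [mul_zero, add_zero] at hb
  exact ⟨key.mono fun n hn => hn.1, squeeze_zero'
    (Eventually.of_forall fun n => integral_nonneg fun ω => sampleDiscrepancy_nonneg _ _)
    (key.mono fun n hn => hn.2) hb⟩

/-- Convergence along the filter on pairs `(n, z)` generated by `n → ∞` and discrepancy `→ 0` is
exactly an estimate uniform in `z`; `δ` and `N` are read off from a basis of this filter. -/
theorem exists_forall_abs_sub_lt_of_sampleDiscrepancy_lt {k : ℕ → ℕ} [∀ n, NeZero (k n)]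
    (hk : Tendsto k atTop atTop) (A : ℕ → Matrix (Fin q) (Fin q) ℝ) (x : Fin q → ℝ) {ε : ℝ}
    (hε : 0 < ε) :
    ∃ δ > 0, ∃ N, ∀ n ≥ N, ∀ z : Fin (k n) → Fin q → ℝ, sampleDiscrepancy (A n) z < δ →
      |(Measure.pi fun _ : Fin (k n) => empiricalMeasure z).real
          {y | √(k n : ℝ) • (A n *ᵥ (sampleMean y - sampleMean z)) ≤ x}
        - (Measure.pi fun _ : Fin q => gaussianReal 0 1).real (Set.Iic x)| < ε := by
  let D (i : Σ n, Fin (k n) → Fin q → ℝ) : ℝ := sampleDiscrepancy (A i.1) i.2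
  let l : Filter (Σ n, Fin (k n) → Fin q → ℝ) := comap D (𝓝 0) ⊓ comap Sigma.fst atTop
  have h := tendsto_pi_empiricalMeasure_sampleMean (l := l) (k := fun i => k i.1)
    (hk.comp (tendsto_comap.mono_left inf_le_right)) (fun i => A i.1) (fun i => i.2)
    (tendsto_comap.mono_left inf_le_left) x
  have hev := h.eventually (Metric.ball_mem_nhds _ hε)
  rw [((Metric.nhds_basis_ball.comap D).inf (atTop_basis.comap Sigma.fst)).eventually_iff] at hev
  obtain ⟨⟨δ, N⟩, ⟨hδ, -⟩, hlt⟩ := hev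
  refine ⟨δ, hδ, N, fun n hn z hz => ?_⟩
  have hmem : D ⟨n, z⟩ ∈ Metric.ball (0 : ℝ) δ := by
    simpa [abs_of_nonneg (sampleDiscrepancy_nonneg _ _), D] using hz
  exact hlt (x := ⟨n, z⟩) ⟨hmem, hn⟩

end Standardization

/-! ### Conclusion by Markov's inequality. -/

theorem theoremA2 {Ω : Type*} [MeasurableSpace Ω] (μ : Measure Ω) [IsProbabilityMeasure μ]
    (q : ℕ) (k : ℕ → ℕ) [∀ n, NeZero (k n)] (hk : Tendsto k atTop atTop)
    -- the triangular array: row `n` consists of the iid centred vectors `ξ n 0, …, ξ n (k n - 1)`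
    (ξ : ∀ n, Fin (k n) → Ω → Fin q → ℝ)
    (hmeas : ∀ n i, Measurable (ξ n i))
    (hindep : ∀ n, iIndepFun (ξ n) μ)
    (hident : ∀ n i, IdentDistrib (ξ n i) (ξ n 0) μ μ)
    (hmean : ∀ n i, ∫ ω, ξ n i ω ∂μ = 0)
    (hmom : ∀ j : Fin q, (⨆ n, ∫⁻ ω, ‖ξ n 0 ω j‖ₑ ^ 4 ∂μ) < ∞)
    -- the bootstrapped rows
    (ξs : ∀ n, Fin (k n) → Ω → Fin q → ℝ)
    (hboot : ∀ n, IsBootstrapVersion (fun ω i => ξs n i ω) (fun ω i => ξ n i ω) μ)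
    -- the covariance matrices have a positive definite liminf (in the Loewner sense)
    (Γ : Matrix (Fin q) (Fin q) ℝ) (hΓ : Γ.PosDef)
    (hliminf : IsLiminfLowerBound Γ fun n => covMatrix (ξ n 0) μ)
    (x : Fin q → ℝ) :
    TendstoInMeasure μ
      (fun n ω =>
        (μ⟦{ω' | √(k n : ℝ) • (invSqrt (covMatrix (ξ n 0) μ) *ᵥ
              (sampleMean (fun i => ξs n i ω') - sampleMean (fun i => ξ n i ω'))) ≤ x} |
            MeasurableSpace.comap (fun ω' i => ξ n i ω') inferInstance⟧) ω
          - μ.real {ω' | √(k n : ℝ) • (invSqrt (covMatrix (ξ n 0) μ) *ᵥ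
              sampleMean (fun i => ξ n i ω')) ≤ x})
      atTop (fun _ => 0) := by
  have hξ (n : ℕ) : Measurable fun ω i => ξ n i ω := measurable_pi_lambda _ (hmeas n)
  obtain ⟨K, hK⟩ := exists_forall_integral_norm_pow_le (fun n => hmeas n 0) four_ne_zero hmom
  have h4 (n : ℕ) := (hK n).1
  obtain ⟨c, hc, hlow⟩ := exists_forall_mul_sq_norm_le_covMatrix (fun n => hmeas n 0)
    (fun n => hmean n 0)
    (fun n => integrable_norm_pow_of_le (by norm_num) (hmeas n 0) (h4 n))
    (fun n => (integral_norm_pow_le_one_add (by norm_num) (hmeas n 0) (h4 n)).trans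
      (add_le_add_right (hK n).2 1)) hΓ hliminf
  set A : ℕ → Matrix (Fin q) (Fin q) ℝ := fun n => invSqrt (covMatrix (ξ n 0) μ)
  have hA (n : ℕ) : (A n)ᵀ = A n := transpose_invSqrt _
  -- Only eventually: finitely many covariance matrices may be singular.
  have hstd : ∀ᶠ n in atTop, A n * covMatrix (ξ n 0) μ * A n = 1 := by
    filter_upwards [hlow] with n hn
    refine invSqrt_mul_mul_invSqrt (Matrix.PosDef.of_dotProduct_mulVec_pos
      (covMatrix_isHermitian _ _) fun v hv => ?_)
    have : 0 < c * ‖v‖ ^ 2 := by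
      have := norm_pos_iff.2 hv
      positivity
    simpa using this.trans_le (hn v)
  have hAK : ∀ᶠ n in atTop, ∫ ω, ‖A n *ᵥ ξ n 0 ω‖ ^ 4 ∂μ ≤ (q / c) ^ 2 * K := by
    filter_upwards [hlow, hstd] with n hn hs
    refine le_trans ?_ (mul_le_mul_of_nonneg_left (hK n).2 (by positivity))
    rw [← integral_const_mul]
    refine integral_mono (integrable_norm_mulVec_pow (A n) (hmeas n 0) (h4 n))
      ((h4 n).const_mul _) fun ω => ?_
    have h1 : ‖A n *ᵥ ξ n 0 ω‖ ^ 2 ≤ q / c * ‖ξ n 0 ω‖ ^ 2 := by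
      rw [div_mul_eq_mul_div, le_div_iff₀' hc]
      exact mul_sq_norm_mulVec_le (hA n) hs hn _
    have h2 := pow_le_pow_left₀ (by positivity) h1 2
    simp only
    calc ‖A n *ᵥ ξ n 0 ω‖ ^ 4 = (‖A n *ᵥ ξ n 0 ω‖ ^ 2) ^ 2 := by ring
      _ ≤ _ := h2
      _ = _ := by ring
  set g := (Measure.pi fun _ : Fin q => gaussianReal 0 1).real (Set.Iic x)
  have hlim : Tendsto _ atTop (𝓝 g) :=
    tendsto_measureReal_sampleMean hk hmeas hindep hident (fun n => hmean n 0) hA hstd h4 hAK x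
  obtain ⟨hDint, hDlim⟩ := tendsto_integral_sampleDiscrepancy hk hmeas hindep hident
    (fun n => hmean n 0) hA hstd h4 hAK
  refine TendstoInMeasure.congr_left (f := fun n ω =>
    (Measure.pi fun _ : Fin (k n) => empiricalMeasure fun i => ξ n i ω).real
        {y | √(k n : ℝ) • (A n *ᵥ (sampleMean y - sampleMean fun i => ξ n i ω)) ≤ x}
      - μ.real {ω' | √(k n : ℝ) • (A n *ᵥ sampleMean fun i => ξ n i ω') ≤ x}) (fun n => ?_) ?_
  · filter_upwards [condExp_bootstrap_ae_eq (hξ n) (hboot n) (A n) x] with ω hω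
    rw [hω]
  rw [tendstoInMeasure_iff_norm]
  intro ε hε
  obtain ⟨δ, hδ, N, hN⟩ :=
    exists_forall_abs_sub_lt_of_sampleDiscrepancy_lt hk A x (half_pos hε)
  have hbound : Tendsto (fun n => ENNReal.ofReal
      ((∫ ω, sampleDiscrepancy (A n) (fun i => ξ n i ω) ∂μ) / δ)) atTop (𝓝 0) := by
    simpa using ENNReal.tendsto_ofReal (hDlim.div_const δ)
  refine tendsto_of_tendsto_of_tendsto_of_le_of_le' tendsto_const_nhds hbound
    (Eventually.of_forall fun _ => zero_le) ?_
  filter_upwards [hDint, eventually_ge_atTop N,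
    hlim.eventually (Metric.ball_mem_nhds _ (half_pos hε))] with n hn hnN hp
  rw [Real.dist_eq, abs_lt] at hp
  -- When the discrepancy is below `δ`, both probabilities lie within `ε / 2` of the Gaussian value
  -- `g`.
  have hsub : {ω | ε ≤ ‖((Measure.pi fun _ : Fin (k n) => empiricalMeasure fun i => ξ n i ω).real
        {y | √(k n : ℝ) • (A n *ᵥ (sampleMean y - sampleMean fun i => ξ n i ω)) ≤ x}
      - μ.real {ω' | √(k n : ℝ) • (A n *ᵥ sampleMean fun i => ξ n i ω') ≤ x}) - 0‖}
      ⊆ {ω | δ ≤ sampleDiscrepancy (A n) fun i => ξ n i ω} := by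
    intro ω hω
    by_contra hlt
    have h1 := abs_lt.1 (hN n hnN (fun i => ξ n i ω) (not_le.1 hlt))
    refine (not_le.2 ?_) (Set.mem_ofPred_eq ▸ hω)
    rw [sub_zero, Real.norm_eq_abs, abs_lt]
    constructor <;> linarith [h1.1, h1.2, hp.1, hp.2]
  refine (measure_mono hsub).trans ?_
  rw [← ofReal_measureReal]
  refine ENNReal.ofReal_le_ofReal ((le_div_iff₀' hδ).2 ?_)
  exact mul_meas_ge_le_integral_of_nonneg
    (ae_of_all _ fun ω => sampleDiscrepancy_nonneg _ _) hn δ
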